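/- A \emph{cube complex} is a polyhedral complex whose cells are Euclidean unit cubes, glued along faces by isometries, such that any two cubes that meet do so in a common face of each. It is \emph{finite-dimensional} if the dimensions of its cubes are bounded, and it is a \emph{CAT(0) cube complex} if its underlying topological space is simply connected (in particular non-empty and connected) and it satisfies Gromov's link condition: in the link of each vertex, every finite set of pairwise adjacent vertices spans a simplex. A discrete metric space $(V,\rho)$ has \emph{Property A} if for all $R,\varepsilon>0$ there exist a map $\xi\colon V\to\ell^1(V)$ and a number $S>0$ such that $\|\xi(x)\|_1=1$ for all $x\in V$; $\|\xi(x)-\xi(y)\|_1\le\varepsilon$ for all $x,y\in V$ with $\rho(x,y)\le R$; and, for each $x\in V$, $\xi(x)$ is supported in the closed ball $B(x;S)$. \textbf{Proposition.} Let $X$ be a finite-dimensional CAT(0) cube complex (not necessarily locally finite). Then $X$ has Property A; that is, its vertex set, equipped with the edge-path metric, has Property A. -/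

import Mathlib

/-- The face of the vertex set `{0,1}ⁿ` of the standard `n`-cube on which the coordinates in `S`
are frozen to the values prescribed by `y`, the other coordinates being free. -/
def cubeFace {n : ℕ} (S : Set (Fin n)) (y : Fin n → Bool) : Set (Fin n → Bool) :=
  {x | ∀ i ∈ S, x i = y i}

/-- A cubical chart with respect to a family `K` of subsets of `V` (the vertex sets of the cubes):
an injective labelling of the vertices of the standard `n`-cube by elements of `V`, such that the
members of `K` inside its image are exactly the images of the faces of the standard cube. -/
def IsCubeChart {V : Type*} (K : Set (Set V)) {n : ℕ} (φ : (Fin n → Bool) → V) : Prop :=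
  Function.Injective φ ∧
    ∀ D : Set V, D ⊆ Set.range φ →
      (D ∈ K ↔ ∃ (S : Set (Fin n)) (y : Fin n → Bool), D = φ '' cubeFace S y)

/-- A cube complex with vertex set `V`. Since any two cubes meet, if at all, in a common face, a
cube is determined by its vertex set; so the complex is recorded by the family of the vertex sets
of its cubes (of all dimensions). Each vertex is a `0`-cube, each cube is a copy of a standard cube
whose faces are exactly the cubes contained in it, and two cubes that meet do so in a common face
(a cube contained in `C` being a face of `C`). -/
structure CubeComplex (V : Type*) where
  /-- The vertex sets of the cubes. -/
  cubes : Set (Set V)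
  singleton_mem : ∀ v : V, {v} ∈ cubes
  exists_chart : ∀ C ∈ cubes, ∃ (n : ℕ) (φ : (Fin n → Bool) → V),
    Set.range φ = C ∧ IsCubeChart cubes φ
  inter_mem : ∀ C ∈ cubes, ∀ D ∈ cubes, (C ∩ D).Nonempty → C ∩ D ∈ cubes

namespace CubeComplex

/-- A parametrised cube of the complex. -/
structure Cell {V : Type*} (X : CubeComplex V) where
  /-- The dimension of the cube. -/
  dim : ℕ
  /-- The vertices of the cube, labelled by `{0,1}ⁿ`. -/
  vertex : (Fin dim → Bool) → V
  isChart : IsCubeChart X.cubes vertex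

/-- The point with coordinates `t ∈ [0,1]ⁿ` of a cube, written through its weights on the vertices:
the corner `x ∈ {0,1}ⁿ` has weight `∏ᵢ (tᵢ if xᵢ = 1, else 1 - tᵢ)`. Weights determine `t`, a corner
has weight one on itself, and a point of a face has the same weights in the face as in the cube. -/
noncomputable def Cell.weight {V : Type*} {X : CubeComplex V} (c : X.Cell)
    (t : Fin c.dim → unitInterval) (v : V) : ℝ :=
  open Classical in
  ∑ x : Fin c.dim → Bool,
    if c.vertex x = v then ∏ i, (if x i = true then (t i : ℝ) else 1 - (t i : ℝ)) else 0

/-- The underlying space of the complex: the unit cubes `[0,1]ⁿ`, one for each parametrised cube,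
with points identified when they have the same weights on the vertices (that is, glued along common
faces). -/
def Realization {V : Type*} (X : CubeComplex V) : Type _ :=
  {w : V → ℝ // ∃ (c : X.Cell) (t : Fin c.dim → unitInterval), c.weight t = w}

/-- The characteristic map `[0,1]ⁿ → |X|` of a parametrised cube. -/
noncomputable def Cell.charMap {V : Type*} {X : CubeComplex V} (c : X.Cell)
    (t : Fin c.dim → unitInterval) : X.Realization :=
  ⟨c.weight t, c, t, rfl⟩

/-- The cell-complex topology: a set is open iff its preimage in each cube `[0,1]ⁿ` is open. -/
noncomputable instance {V : Type*} (X : CubeComplex V) : TopologicalSpace X.Realization :=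
  ⨆ c : X.Cell, TopologicalSpace.coinduced c.charMap inferInstance

/-- The graph formed by the vertices and the edges (one-dimensional cubes). -/
def edgeGraph {V : Type*} (X : CubeComplex V) : SimpleGraph V where
  Adj u v := u ≠ v ∧ {u, v} ∈ X.cubes
  symm := ⟨fun u v h => ⟨h.1.symm, by rw [Set.pair_comm]; exact h.2⟩⟩
  loopless := ⟨fun _ h => h.1 rfl⟩

/-- The link of the vertex `v`, as the family of its simplices (including the empty one). Its
vertices are the edges at `v`, represented by their other endpoints, and each cube `C` containing
`v` contributes the simplex of the edges of `C` at `v`. -/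
def link {V : Type*} (X : CubeComplex V) (v : V) : Set (Set V) :=
  {A | ∃ C ∈ X.cubes, v ∈ C ∧ A = {u | u ∈ C ∧ X.edgeGraph.Adj v u}}

/-- Gromov's link condition: every vertex link is a flag complex, that is, any finite set of
pairwise adjacent vertices of the link spans a simplex (`u = w` says that `u` is a vertex). -/
def LinkCondition {V : Type*} (X : CubeComplex V) : Prop :=
  ∀ v : V, ∀ A : Set V, A.Finite → (∀ u ∈ A, ∀ w ∈ A, {u, w} ∈ X.link v) → A ∈ X.link v

/-- A CAT(0) cube complex: simply connected, with Gromov's link condition. -/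
structure IsCAT0 {V : Type*} (X : CubeComplex V) : Prop where
  simplyConnected : SimplyConnectedSpace X.Realization
  linkCondition : X.LinkCondition

/-- The dimensions of the cubes are bounded. -/
def IsFiniteDimensional {V : Type*} (X : CubeComplex V) : Prop :=
  ∃ d : ℕ, ∀ c : X.Cell, c.dim ≤ d

end CubeComplex

/-- The edge-path metric on the vertices of a connected graph. -/
noncomputable abbrev edgePathMetric {V : Type*} {G : SimpleGraph V} (hG : G.Connected) :
    MetricSpace V where
  dist u v := (G.dist u v : ℝ)
  dist_self u := by simp
  dist_comm u v := by rw [SimpleGraph.dist_comm]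
  dist_triangle u v w := by exact_mod_cast hG.dist_triangle
  eq_of_dist_eq_zero {u v} h := by
    have h' : G.dist u v = 0 := by exact_mod_cast h
    exact hG.dist_eq_zero_iff.mp h'

/-- Yu's Property A, through maps into the unit sphere of `ℓ¹(X)`. -/
def HasPropertyA (X : Type*) [MetricSpace X] : Prop :=
  ∀ R > (0 : ℝ), ∀ ε > (0 : ℝ), ∃ ξ : X → lp (fun _ : X => ℝ) 1,
    (∀ x, ‖ξ x‖ = 1) ∧
    (∀ x y, dist x y ≤ R → ‖ξ x - ξ y‖ ≤ ε) ∧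
    ∃ S > (0 : ℝ), ∀ x, Function.support (ξ x : X → ℝ) ⊆ Metric.closedBall x S

/-! Fix a vertex `o` and move every vertex towards it, each step crossing all minimal halfspaces
that separate it from `o`. After `l` steps, the ball of radius `k ≤ l` about `x` lands among the
vertices between `x` and `o` at distance at most `(d + 1) * l` from `x`. Balls may be infinite, but
these interval pieces have polynomial size (`intervalBall_finite_and_ncard_le`): a vertex `z` of the
interval is encoded by the at most `d` maximal halfspaces separating `x` from `z`. Averaging over
`k` the uniform distributions on the images gives Property A: the variation is bounded by a
telescoping sum of logarithms of cardinalities, and the logarithm of a polynomial is sublinear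
(`hasPropertyA_of_shadows`).

The halfspace geometry rests on `IsQuadrangular`, which is extracted from the topology as follows.
Edge paths to `o` are taken modulo swaps across squares. The link condition yields a diamond lemma
(`SwapEq.diamond`), whence the classes of reduced paths at adjacent vertices correspond bijectively,
compatibly around squares. This local system defines a covering of the realization; simple
connectivity gives a section through the trivial path, so each vertex carries exactly one reduced
class. Geodesics are reduced, so any two geodesics with the same ends are related by swaps. -/

namespace CubeComplex

/-! ### Combinatorics of the standard cube -/

/-- The vertex of the standard cube that differs from `x` exactly in the `i`-th coordinate. -/
def flipAt {n : ℕ} (x : Fin n → Bool) (i : Fin n) : Fin n → Bool :=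
  Function.update x i (!x i)

section flipAt

variable {n : ℕ} (x : Fin n → Bool) (i j : Fin n)

@[simp] theorem flipAt_same : flipAt x i i = !x i := by simp [flipAt]

theorem flipAt_of_ne {i j : Fin n} (h : j ≠ i) : flipAt x i j = x j := by simp [flipAt, h]

@[simp] theorem flipAt_flipAt : flipAt (flipAt x i) i = x := by
  funext k
  by_cases h : k = i
  · subst h; simp
  · simp [flipAt_of_ne _ h]

theorem flipAt_comm : flipAt (flipAt x i) j = flipAt (flipAt x j) i := by
  funext k
  by_cases hi : k = i <;> by_cases hj : k = j
  · subst hi; subst hj; rfl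
  · subst hi; simp [flipAt_of_ne _ hj]
  · subst hj; simp [flipAt_of_ne _ hi]
  · simp [flipAt_of_ne _ hi, flipAt_of_ne _ hj]

theorem flipAt_ne : flipAt x i ≠ x := fun h => by
  have := congrFun h i
  simp at this

theorem flipAt_injective : Function.Injective (flipAt x) := fun i j h => by
  by_contra hij
  have := congrFun h i
  rw [flipAt_same, flipAt_of_ne _ hij] at this
  simp at this

theorem flipAt_flipAt_ne {i j : Fin n} (h : i ≠ j) : flipAt (flipAt x i) j ≠ x := fun e => by
  have := congrFun e i
  rw [flipAt_of_ne _ h, flipAt_same] at this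
  simp at this

theorem flipAt_flipAt_ne_flipAt {i j : Fin n} (h : i ≠ j) (k : Fin n) :
    flipAt (flipAt x i) j ≠ flipAt x k := fun e => by
  have hi := congrFun e i
  have hj := congrFun e j
  rw [flipAt_of_ne _ h, flipAt_same] at hi
  rw [flipAt_same, flipAt_of_ne _ h.symm] at hj
  by_cases hik : i = k
  · subst hik
    rw [flipAt_of_ne _ h.symm] at hj
    simp at hj
  · rw [flipAt_of_ne _ hik] at hi
    simp at hi

/-- A function on the vertices of the standard cube that is constant along edges is constant. -/
theorem eq_of_flipAt_eq {α : Type*} (f : (Fin n → Bool) → α) (h : ∀ x i, f (flipAt x i) = f x)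
    (x y : Fin n → Bool) : f x = f y := by
  suffices H : ∀ s : Finset (Fin n), ∀ x, (∀ i ∉ s, x i = y i) → f x = f y from
    H Finset.univ x (by simp)
  intro s
  induction s using Finset.induction_on with
  | empty => exact fun x hx => congrArg f (funext fun i => hx i (by simp))
  | insert j s hj ih =>
    intro x hx
    by_cases hxy : x j = y j
    · refine ih x fun i hi => ?_
      by_cases hij : i = j
      · rw [hij, hxy]
      · exact hx i (by simp [hi, hij])
    · rw [← h x j]
      refine ih _ fun i hi => ?_
      by_cases hij : i = j
      · subst hij
        rw [flipAt_same]
        cases h1 : x i <;> cases h2 : y i <;> simp_all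
      · rw [flipAt_of_ne _ hij]
        exact hx i (by simp [hi, hij])

end flipAt

/-! ### Charts, squares and the link condition -/

section charts

variable {V : Type*} {X : CubeComplex V} {n : ℕ} {φ : (Fin n → Bool) → V}

theorem face_mem_cubes (hφ : IsCubeChart X.cubes φ) (S : Set (Fin n)) (y : Fin n → Bool) :
    φ '' cubeFace S y ∈ X.cubes :=
  (hφ.2 _ (Set.image_subset_range _ _)).2 ⟨S, y, rfl⟩

theorem range_mem_cubes (hφ : IsCubeChart X.cubes φ) : Set.range φ ∈ X.cubes := by
  have := face_mem_cubes hφ ∅ (fun _ => false)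
  simpa [cubeFace] using this

theorem adj_flipAt (hφ : IsCubeChart X.cubes φ) (x : Fin n → Bool) (i : Fin n) :
    X.edgeGraph.Adj (φ x) (φ (flipAt x i)) := by
  refine ⟨fun h => flipAt_ne x i (hφ.1 h).symm, ?_⟩
  convert face_mem_cubes hφ {i}ᶜ x
  rw [← Set.image_pair]
  congr 1
  ext y
  simp only [Set.mem_insert_iff, Set.mem_singleton_iff, cubeFace, Set.mem_compl_iff,
    Set.mem_ofPred_eq]
  constructor
  · rintro (rfl | rfl) k hk
    · rfl
    · exact flipAt_of_ne _ hk
  · intro h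
    by_cases hi : y i = x i
    · left
      funext k
      by_cases hk : k = i
      · rw [hk, hi]
      · exact h k hk
    · right
      funext k
      by_cases hk : k = i
      · subst hk
        rw [flipAt_same]
        cases h1 : x k <;> cases h2 : y k <;> simp_all
      · rw [flipAt_of_ne _ hk]
        exact h k hk

/-- The neighbours of a vertex within a cube are obtained by changing one coordinate. -/
theorem exists_flipAt_of_adj (hφ : IsCubeChart X.cubes φ) {x : Fin n → Bool} {u : V}
    (hu : u ∈ Set.range φ) (h : X.edgeGraph.Adj (φ x) u) : ∃ i, u = φ (flipAt x i) := by
  obtain ⟨x', rfl⟩ := hu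
  have hne : x ≠ x' := fun e => h.1 (congrArg φ e)
  obtain ⟨S, y, hS⟩ := (hφ.2 {φ x, φ x'} (by rintro _ (rfl | rfl) <;> exact ⟨_, rfl⟩)).1 h.2
  rw [← Set.image_pair] at hS
  have hS' : {x, x'} = cubeFace S y := hφ.1.image_injective hS
  have hx : x ∈ cubeFace S y := hS' ▸ Set.mem_insert _ _
  have hx' : x' ∈ cubeFace S y := hS' ▸ Set.mem_insert_of_mem _ rfl
  obtain ⟨i, hi⟩ := Function.ne_iff.1 hne
  have hiS : i ∉ S := fun his => hi ((hx i his).trans (hx' i his).symm)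
  -- The coordinate `i` is free in the face, so flipping it stays in the face, which has only the
  -- two elements `x` and `x'`.
  have hf : flipAt x i ∈ cubeFace S y := fun k hk => by
    rw [flipAt_of_ne _ (show k ≠ i from fun e => hiS (e ▸ hk))]
    exact hx k hk
  rw [← hS'] at hf
  rcases hf with hf | hf
  · exact absurd hf (flipAt_ne x i)
  · exact ⟨i, by rw [Set.mem_singleton_iff.1 hf]⟩

/-- `a b c d` are the vertices of a square of the complex, in cyclic order. -/
structure Sq (X : CubeComplex V) (a b c d : V) : Prop where
  mem : ({a, b, c, d} : Set V) ∈ X.cubes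
  ac : a ≠ c
  bd : b ≠ d
  ab : X.edgeGraph.Adj a b
  bc : X.edgeGraph.Adj b c
  cd : X.edgeGraph.Adj c d
  da : X.edgeGraph.Adj d a

namespace Sq

variable {a b c d : V}

theorem rotate (h : X.Sq a b c d) : X.Sq b c d a where
  mem := by
    convert h.mem using 1
    ext; simp only [Set.mem_insert_iff, Set.mem_singleton_iff]; tauto
  ac := h.bd
  bd := h.ac.symm
  ab := h.bc
  bc := h.cd
  cd := h.da
  da := h.ab

theorem reflect (h : X.Sq a b c d) : X.Sq a d c b where
  mem := by
    convert h.mem using 1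
    ext; simp only [Set.mem_insert_iff, Set.mem_singleton_iff]; tauto
  ac := h.ac
  bd := h.bd.symm
  ab := h.da.symm
  bc := h.cd.symm
  cd := h.bc.symm
  da := h.ab.symm

/-- Two edges at a vertex of a cube that stay in the cube are edges of a chart in different
directions. -/
theorem exists_chart_of_mem {C : Set V} (hC : C ∈ X.cubes) (ha : a ∈ C) (hb : b ∈ C) (hc : c ∈ C)
    (hab : X.edgeGraph.Adj b a) (hbc : X.edgeGraph.Adj b c) (hac : a ≠ c) :
    ∃ (n : ℕ) (φ : (Fin n → Bool) → V) (x : Fin n → Bool) (i j : Fin n), Set.range φ = C ∧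
      IsCubeChart X.cubes φ ∧ i ≠ j ∧ φ x = b ∧ φ (flipAt x i) = a ∧ φ (flipAt x j) = c := by
  obtain ⟨n, φ, rfl, hφ⟩ := X.exists_chart C hC
  obtain ⟨x, rfl⟩ := hb
  obtain ⟨i, rfl⟩ := exists_flipAt_of_adj hφ ha hab
  obtain ⟨j, rfl⟩ := exists_flipAt_of_adj hφ hc hbc
  exact ⟨n, φ, x, i, j, rfl, hφ, fun h => hac (by rw [h]), rfl, rfl, rfl⟩

/-- Two squares with three common vertices coincide. -/
theorem unique {d' : V} (h : X.Sq a b c d) (h' : X.Sq a b c d') : d = d' := by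
  -- The intersection of the squares is a cube containing the two edges at `b`, hence also the
  -- corner opposite to `b`; that corner is both `d` and `d'`.
  have hne : (({a, b, c, d} : Set V) ∩ {a, b, c, d'}).Nonempty := ⟨a, by simp, by simp⟩
  obtain ⟨n, φ, x, i, j, hr, hφ, hij, hb, ha, hc⟩ := exists_chart_of_mem (a := a) (b := b) (c := c)
    (X.inter_mem _ h.mem _ h'.mem hne) ⟨by simp, by simp⟩ ⟨by simp, by simp⟩ ⟨by simp, by simp⟩
    h.ab.symm h.bc h.ac
  have hz : φ (flipAt (flipAt x i) j) ∈ Set.range φ := ⟨_, rfl⟩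
  rw [hr] at hz
  have hza : φ (flipAt (flipAt x i) j) ≠ a := fun e =>
    flipAt_flipAt_ne_flipAt x hij i (hφ.1 (e.trans ha.symm))
  have hzc : φ (flipAt (flipAt x i) j) ≠ c := fun e =>
    flipAt_flipAt_ne_flipAt x hij j (hφ.1 (e.trans hc.symm))
  have hzb : φ (flipAt (flipAt x i) j) ≠ b := fun e =>
    flipAt_flipAt_ne x hij (hφ.1 (e.trans hb.symm))
  simp only [Set.mem_inter_iff, Set.mem_insert_iff, Set.mem_singleton_iff, hza, hzb, hzc,
    false_or] at hz
  exact hz.1.symm.trans hz.2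

theorem unique_diag {c' : V} (h : X.Sq a b c d) (h' : X.Sq a b c' d) : c = c' :=
  h.rotate.rotate.rotate.unique h'.rotate.rotate.rotate

theorem of_chart (hφ : IsCubeChart X.cubes φ) (x : Fin n → Bool) {i j : Fin n} (hij : i ≠ j) :
    X.Sq (φ x) (φ (flipAt x i)) (φ (flipAt (flipAt x i) j)) (φ (flipAt x j)) where
  ac := fun e => flipAt_flipAt_ne x hij (hφ.1 e).symm
  bd := fun e => hij (flipAt_injective x (hφ.1 e))
  ab := adj_flipAt hφ _ _
  bc := adj_flipAt hφ _ _
  cd := by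
    rw [flipAt_comm]
    exact (adj_flipAt hφ _ _).symm
  da := (adj_flipAt hφ _ _).symm
  mem := by
    convert face_mem_cubes hφ {i, j}ᶜ x
    have : cubeFace {i, j}ᶜ x = {x, flipAt x i, flipAt (flipAt x i) j, flipAt x j} := by
      ext y
      simp only [Set.mem_insert_iff, Set.mem_singleton_iff, cubeFace, Set.mem_compl_iff,
        Set.mem_ofPred_eq, not_or]
      constructor
      · intro h
        have key : ∀ z : Fin n → Bool, (∀ k, k ≠ i → k ≠ j → z k = x k) → y i = z i → y j = z j →
            y = z := fun z hz hi hj => funext fun k => by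
          by_cases hki : k = i
          · rw [hki, hi]
          by_cases hkj : k = j
          · rw [hkj, hj]
          rw [hz k hki hkj, h k ⟨hki, hkj⟩]
        have hi : y i = x i ∨ y i = !x i := by cases y i <;> cases x i <;> simp
        have hj : y j = x j ∨ y j = !x j := by cases y j <;> cases x j <;> simp
        rcases hi with hi | hi <;> rcases hj with hj | hj
        · exact Or.inl (key _ (fun _ _ _ => rfl) hi hj)
        · exact Or.inr (Or.inr (Or.inr (key _ (fun k _ hk => flipAt_of_ne _ hk)
            (by rw [flipAt_of_ne _ hij, hi]) (by rw [flipAt_same, hj]))))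
        · exact Or.inr (Or.inl (key _ (fun k hk _ => flipAt_of_ne _ hk)
            (by rw [flipAt_same, hi]) (by rw [flipAt_of_ne _ hij.symm, hj])))
        · exact Or.inr (Or.inr (Or.inl (key _
            (fun k hk hk' => by rw [flipAt_of_ne _ hk', flipAt_of_ne _ hk])
            (by rw [flipAt_of_ne _ hij, flipAt_same, hi])
            (by rw [flipAt_same, flipAt_of_ne _ hij.symm, hj]))))
      · rintro (rfl | rfl | rfl | rfl) k ⟨hi, hj⟩
        · rfl
        · rw [flipAt_of_ne _ hi]
        · rw [flipAt_of_ne _ hj, flipAt_of_ne _ hi]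
        · rw [flipAt_of_ne _ hj]
    rw [this]
    simp only [Set.image_insert_eq, Set.image_singleton]

/-- In a chart of the square, `c` differs from `a` in two coordinates, whereas neighbours inside a
cube differ in one. -/
theorem not_adj_diag (h : X.Sq a b c d) : ¬ X.edgeGraph.Adj a c := fun hadj => by
  obtain ⟨n, φ, x, i, j, hr, hφ, hij, hb, ha, hc⟩ := exists_chart_of_mem (a := b) (b := a) (c := d)
    h.mem (by simp) (by simp) (by simp) h.ab h.da.symm h.bd
  have hz := of_chart hφ x hij
  rw [hb, ha, hc] at hz
  have hcz : c = φ (flipAt (flipAt x i) j) := by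
    have hz : φ (flipAt (flipAt x i) j) ∈ Set.range φ := ⟨_, rfl⟩
    have hzb : φ (flipAt (flipAt x i) j) ≠ b := fun e =>
      flipAt_flipAt_ne_flipAt x hij i (hφ.1 (e.trans ha.symm))
    have hzd : φ (flipAt (flipAt x i) j) ≠ d := fun e =>
      flipAt_flipAt_ne_flipAt x hij j (hφ.1 (e.trans hc.symm))
    have hza : φ (flipAt (flipAt x i) j) ≠ a := fun e =>
      flipAt_flipAt_ne x hij (hφ.1 (e.trans hb.symm))
    rw [hr] at hz
    simpa [hza, hzb, hzd, eq_comm] using hz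
  obtain ⟨k, hk⟩ := exists_flipAt_of_adj hφ (x := x) (u := c) (by rw [hr]; simp) (hb ▸ hadj)
  exact flipAt_flipAt_ne_flipAt x hij k (hφ.1 (hcz.symm.trans hk))

theorem pair_mem_link (h : X.Sq a b c d) : {b, d} ∈ X.link a := by
  refine ⟨_, h.mem, by simp, ?_⟩
  ext u
  simp only [Set.mem_insert_iff, Set.mem_singleton_iff, Set.mem_ofPred_eq]
  constructor
  · rintro (rfl | rfl)
    · exact ⟨by simp, h.ab⟩
    · exact ⟨by simp, h.da.symm⟩
  · rintro ⟨rfl | rfl | rfl | rfl, hu⟩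
    · exact absurd rfl hu.1
    · exact Or.inl rfl
    · exact absurd hu h.not_adj_diag
    · exact Or.inr rfl

end Sq

theorem singleton_mem_link {v u : V} (h : X.edgeGraph.Adj v u) : {u} ∈ X.link v := by
  refine ⟨_, h.2, by simp, ?_⟩
  ext w
  simp only [Set.mem_insert_iff, Set.mem_singleton_iff, Set.mem_ofPred_eq]
  constructor
  · rintro rfl
    exact ⟨Or.inr rfl, h⟩
  · rintro ⟨rfl | rfl, hw⟩
    · exact absurd rfl hw.1
    · rfl

/-- Under the link condition, finitely many edges at `v` that pairwise span squares are the edges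
at `v` of a cube. -/
theorem LinkCondition.exists_chart (hX : X.LinkCondition) {v : V} {A : Set V} (hA : A.Finite)
    (hadj : ∀ u ∈ A, X.edgeGraph.Adj v u)
    (hsq : ∀ u ∈ A, ∀ w ∈ A, u ≠ w → ∃ t, X.Sq v u t w) :
    ∃ (n : ℕ) (φ : (Fin n → Bool) → V) (x : Fin n → Bool), IsCubeChart X.cubes φ ∧ φ x = v ∧
      ∀ u ∈ A, ∃ i, u = φ (flipAt x i) := by
  obtain ⟨C, hC, hv, hAC⟩ := hX v A hA fun u hu w hw => by
    by_cases huw : u = w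
    · subst huw
      simpa using singleton_mem_link (hadj u hu)
    · exact (hsq u hu w hw huw).choose_spec.pair_mem_link
  obtain ⟨n, φ, rfl, hφ⟩ := X.exists_chart C hC
  obtain ⟨x, rfl⟩ := hv
  refine ⟨n, φ, x, hφ, rfl, fun u hu => ?_⟩
  rw [hAC] at hu
  exact exists_flipAt_of_adj hφ hu.1 hu.2

/-- All edges of `A` lie in one cube, in distinct coordinate directions. This is where the dimension
bound enters. -/
theorem LinkCondition.ncard_le (hX : X.LinkCondition) {d : ℕ} (hd : ∀ c : X.Cell, c.dim ≤ d)
    {v : V} {A : Finset V} (hadj : ∀ u ∈ A, X.edgeGraph.Adj v u)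
    (hsq : ∀ u ∈ A, ∀ w ∈ A, u ≠ w → ∃ t, X.Sq v u t w) : A.card ≤ d := by
  classical
  obtain ⟨n, φ, x, hφ, -, hA⟩ := hX.exists_chart A.finite_toSet hadj hsq
  calc A.card ≤ (Finset.univ.image fun i => φ (flipAt x i)).card :=
        Finset.card_le_card fun u hu => by
          obtain ⟨i, rfl⟩ := hA u hu
          exact Finset.mem_image_of_mem _ (Finset.mem_univ i)
    _ ≤ n := Finset.card_image_le.trans (by simp)
    _ ≤ d := hd ⟨n, φ, hφ⟩

/-- Three squares around a vertex `v` that pairwise share an edge at `v` lie in a 3-cube. -/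
theorem LinkCondition.exists_opposite (hX : X.LinkCondition) {v a b₀ b₁ v₀ v₂ c : V}
    (h₀ : X.Sq a v₀ b₀ v) (h₁ : X.Sq a v b₁ v₂) (h₂ : X.Sq v b₀ c b₁) :
    ∃ z, X.Sq a v₀ z v₂ ∧ X.Sq v₀ b₀ c z ∧ X.Sq v₂ b₁ c z := by
  have e₀ : X.Sq v a v₀ b₀ := h₀.rotate.rotate.rotate
  have e₁ : X.Sq v a v₂ b₁ := h₁.rotate.reflect
  obtain ⟨n, φ, x, hφ, rfl, hA⟩ := hX.exists_chart (v := v) (A := {a, b₀, b₁}) (by simp)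
    (by rintro u (rfl | rfl | rfl); exacts [e₀.ab, h₂.ab, h₂.da.symm])
    (by
      rintro u (rfl | rfl | rfl) w (rfl | rfl | rfl) hne
      · exact absurd rfl hne
      · exact ⟨_, e₀⟩
      · exact ⟨_, e₁⟩
      · exact ⟨_, e₀.reflect⟩
      · exact absurd rfl hne
      · exact ⟨_, h₂⟩
      · exact ⟨_, e₁.reflect⟩
      · exact ⟨_, h₂.reflect⟩
      · exact absurd rfl hne)
  obtain ⟨i, rfl⟩ := hA a (by simp)
  obtain ⟨j, rfl⟩ := hA b₀ (by simp)
  obtain ⟨k, rfl⟩ := hA b₁ (by simp)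
  have hij : i ≠ j := fun e => h₀.ac (by rw [e])
  have hik : i ≠ k := fun e => h₁.ac (by rw [e])
  have hjk : j ≠ k := fun e => h₂.bd (by rw [e])
  -- Three vertices determine a square, so `v₀`, `v₂`, `c` are the double flips of `v`; the new
  -- vertex is the triple flip.
  have q₀ := e₀.unique_diag (Sq.of_chart hφ x hij)
  have q₁ := e₁.unique_diag (Sq.of_chart hφ x hik)
  have q₂ := h₂.unique_diag (Sq.of_chart hφ x hjk)
  subst q₀ q₁ q₂
  refine ⟨φ (flipAt (flipAt (flipAt x i) j) k), ?_, ?_, ?_⟩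
  · exact Sq.of_chart hφ (flipAt x i) hjk
  · have := Sq.of_chart hφ (flipAt (flipAt x i) j) hik
    rw [flipAt_comm x i j, flipAt_flipAt, flipAt_comm x j i] at this
    exact this
  · have := Sq.of_chart hφ (flipAt (flipAt x i) k) hij
    rw [flipAt_comm x i k, flipAt_flipAt, flipAt_comm x k i, flipAt_comm x k j,
      flipAt_comm (flipAt x i) k j] at this
    exact this

end charts

end CubeComplex

namespace CubeComplex

/-! ### Edge paths modulo swaps, and reduced paths -/

section traces

variable {V : Type*} {X : CubeComplex V} {o : V}

/-- Two edge paths ending at `o` are swap-equivalent if they are related by a sequence of moves,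
each replacing two consecutive edges of a square by the two opposite ones. -/
inductive SwapEq (X : CubeComplex V) {o : V} :
    ∀ {v : V}, X.edgeGraph.Walk v o → X.edgeGraph.Walk v o → Prop
  | refl {v : V} (p : X.edgeGraph.Walk v o) : SwapEq X p p
  | symm {v : V} {p q : X.edgeGraph.Walk v o} : SwapEq X p q → SwapEq X q p
  | trans {v : V} {p q r : X.edgeGraph.Walk v o} : SwapEq X p q → SwapEq X q r → SwapEq X p r
  | cons {a v : V} (h : X.edgeGraph.Adj a v) {p q : X.edgeGraph.Walk v o} :
      SwapEq X p q → SwapEq X (.cons h p) (.cons h q)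
  | swap {a v b w : V} (s : X.Sq a v b w) (p : X.edgeGraph.Walk b o) :
      SwapEq X (.cons s.ab (.cons s.bc p)) (.cons s.da.symm (.cons s.cd.symm p))

theorem SwapEq.length_eq {v : V} {p q : X.edgeGraph.Walk v o} (h : X.SwapEq p q) :
    p.length = q.length := by
  induction h with
  | refl => rfl
  | symm _ ih => exact ih.symm
  | trans _ _ ih ih' => exact ih.trans ih'
  | cons _ _ ih => simp [ih]
  | swap => simp

/-- The relation between swap-equivalent paths that is visible at their first edges: these agree,
or they span a square along which both paths can be made to run. -/
inductive Diamond (X : CubeComplex V) {o : V} :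
    ∀ {a : V}, X.edgeGraph.Walk a o → X.edgeGraph.Walk a o → Prop
  | nil : Diamond X .nil .nil
  | same {a v : V} (h : X.edgeGraph.Adj a v) {p q : X.edgeGraph.Walk v o} (hpq : X.SwapEq p q) :
      Diamond X (.cons h p) (.cons h q)
  | sq {a v b w : V} (s : X.Sq a v b w) (h : X.edgeGraph.Adj a v) (h' : X.edgeGraph.Adj a w)
      {p : X.edgeGraph.Walk v o} {q : X.edgeGraph.Walk w o}
      (r : X.edgeGraph.Walk b o) (hp : X.SwapEq p (.cons s.bc r))
      (hq : X.SwapEq q (.cons s.cd.symm r)) : Diamond X (.cons h p) (.cons h' q)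

theorem Diamond.refl {a : V} (p : X.edgeGraph.Walk a o) : X.Diamond p p := by
  cases p with
  | nil => exact .nil
  | cons h p => exact .same h (.refl p)

theorem Diamond.symm {a : V} {p q : X.edgeGraph.Walk a o} (h : X.Diamond p q) :
    X.Diamond q p := by
  cases h with
  | nil => exact .nil
  | same h hpq => exact .same h hpq.symm
  | sq s h h' r hp hq => exact .sq s.reflect h' h r hq hp

/-- In the main case two squares at `a` share the first edge of `p₁`. The hypothesis `ih`, applied
to the tails beyond that edge, either identifies the two squares or supplies a third one; then the
link condition completes a 3-cube, whose remaining faces give the required square and swaps. -/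
theorem Diamond.trans (hX : X.LinkCondition) {a : V} {p₀ p₁ p₂ : X.edgeGraph.Walk a o}
    (ih : ∀ (v : V) (p q : X.edgeGraph.Walk v o), p.length < p₁.length → X.SwapEq p q →
      X.Diamond p q)
    (h₀ : X.Diamond p₀ p₁) (h₁ : X.Diamond p₁ p₂) : X.Diamond p₀ p₂ := by
  cases h₀ with
  | nil => exact h₁
  | same h hpq =>
    cases h₁ with
    | same _ hqr => exact .same h (hpq.trans hqr)
    | sq s _ h' r hq hr => exact .sq s h h' r (hpq.trans hq) hr
  | sq s₀ h h' r₀ hp hq =>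
    cases h₁ with
    | same _ hqr => exact .sq s₀ h h' r₀ hp (hqr.symm.trans hq)
    | sq s₁ _ h'' r₁ hq' hr =>
      have key := ih _ _ _ (by rw [← hq.length_eq]; simp) (hq.symm.trans hq')
      generalize hc : SimpleGraph.Walk.cons s₀.cd.symm r₀ = c₀ at key
      generalize hc' : SimpleGraph.Walk.cons s₁.bc r₁ = c₁ at key
      cases key with
      | nil => cases hc
      | same h₃ hrr =>
        cases hc
        cases hc'
        obtain rfl := s₀.reflect.unique s₁
        exact .same h (hp.trans ((SwapEq.cons _ hrr).trans hr.symm))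
      | sq s₂ h₃ h₄ t ht ht' =>
        cases hc
        cases hc'
        obtain ⟨z, z₀, z₁, z₂⟩ := hX.exists_opposite s₀ s₁ s₂
        refine .sq z₀ h h'' (.cons z₁.cd.symm t) ?_ ?_
        · exact hp.trans ((SwapEq.cons _ ht).trans (SwapEq.swap z₁ t))
        · exact hr.trans ((SwapEq.cons _ ht').trans (SwapEq.swap z₂ t))

/-- The diamond lemma for swap-equivalent paths. -/
theorem SwapEq.diamond (hX : X.LinkCondition) {a : V} {p q : X.edgeGraph.Walk a o}
    (h : X.SwapEq p q) : X.Diamond p q := by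
  suffices H : ∀ n, ∀ (v : V) (p q : X.edgeGraph.Walk v o), p.length = n → X.SwapEq p q →
      X.Diamond p q from H _ _ _ _ rfl h
  intro n
  induction n using Nat.strong_induction_on with
  | _ n ih =>
    intro v p q hn hpq
    -- The inner induction is on the derivation; the outer one, on length, serves only transitivity.
    induction hpq with
    | refl p => exact .refl p
    | symm h ih' => exact (ih' (h.length_eq.trans hn)).symm
    | trans h h' ih₀ ih₁ =>
      have hn' := h.length_eq.symm.trans hn
      exact Diamond.trans hX (fun v p q hp hpq => ih _ (hn' ▸ hp) v p q rfl hpq) (ih₀ hn) (ih₁ hn')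
    | cons h hpq _ => exact .same h hpq
    | swap s p => exact .sq s _ _ p (.refl _) (.refl _)

/-- Swap-equivalence is left cancellative: the square alternative would have two equal opposite
corners. -/
theorem SwapEq.of_cons (hX : X.LinkCondition) {a v : V} {h h' : X.edgeGraph.Adj a v}
    {p q : X.edgeGraph.Walk v o} (hpq : X.SwapEq (.cons h p) (.cons h' q)) : X.SwapEq p q := by
  cases hpq.diamond hX with
  | same _ h => exact h
  | sq s => exact absurd rfl s.bd

theorem SwapEq.exists_sq (hX : X.LinkCondition) {a v w : V} {h : X.edgeGraph.Adj a v}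
    {h' : X.edgeGraph.Adj a w} {p : X.edgeGraph.Walk v o} {q : X.edgeGraph.Walk w o}
    (hpq : X.SwapEq (.cons h p) (.cons h' q)) (hvw : v ≠ w) :
    ∃ (b : V) (s : X.Sq a v b w) (r : X.edgeGraph.Walk b o),
      X.SwapEq p (.cons s.bc r) ∧ X.SwapEq q (.cons s.cd.symm r) := by
  cases hpq.diamond hX with
  | same => exact absurd rfl hvw
  | sq s _ _ r hp hq => exact ⟨_, s, r, hp, hq⟩

/-- A path is reduced if no sequence of swaps makes it backtrack. -/
def IsReduced (X : CubeComplex V) {o : V} : ∀ {v : V}, X.edgeGraph.Walk v o → Prop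
  | _, .nil => True
  | a, .cons (v := v) _ p => IsReduced X p ∧
      ¬ ∃ (h' : X.edgeGraph.Adj v a) (q : X.edgeGraph.Walk a o), X.SwapEq p (.cons h' q)

/-- The definition inspects only the tails of the given path, so invariance needs the diamond lemma,
with induction on length. -/
theorem IsReduced.swapEq (hX : X.LinkCondition) {v : V} {p q : X.edgeGraph.Walk v o}
    (hp : X.IsReduced p) (hpq : X.SwapEq p q) : X.IsReduced q := by
  suffices H : ∀ n, ∀ (v : V) (p q : X.edgeGraph.Walk v o), p.length = n → X.IsReduced p →
      X.SwapEq p q → X.IsReduced q from H _ _ _ _ rfl hp hpq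
  clear hp hpq p q v
  intro n
  induction n using Nat.strong_induction_on with
  | _ n ih =>
    intro v p q hn hp hpq
    cases hpq.diamond hX with
    | nil => exact hp
    | same h hpq' =>
      refine ⟨ih _ (by rw [← hn]; simp) _ _ _ rfl hp.1 hpq', ?_⟩
      rintro ⟨h', r, hr⟩
      exact hp.2 ⟨h', r, hpq'.trans hr⟩
    | @sq _ v b w s h h' p q r hp' hq' =>
      have hr : X.IsReduced (.cons s.bc r) := ih _ (by rw [← hn]; simp) _ _ _ rfl hp.1 hp'
      -- If `r` could start by going to `w`, a swap across the square would make `p` start by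
      -- returning to `a`.
      have hr' : X.IsReduced (.cons s.cd.symm r) := by
        refine ⟨hr.1, ?_⟩
        rintro ⟨h₁, t, ht⟩
        exact hp.2 ⟨s.ab.symm, .cons s.da.symm t,
          hp'.trans ((SwapEq.cons _ ht).trans (SwapEq.swap s.rotate t))⟩
      refine ⟨ih _ ?_ _ _ _ rfl hr' hq'.symm, ?_⟩
      · have := hp'.length_eq
        simp only [SimpleGraph.Walk.length_cons] at hn this ⊢
        omega
      -- If `q` could return to `a`, the diamond lemma at `w` would give back the same square and
      -- make `r` return to `v`.
      rintro ⟨h₁, t, ht⟩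
      obtain ⟨c, s', t', hc, -⟩ := SwapEq.exists_sq hX (hq'.symm.trans ht) s.ac.symm
      obtain rfl : c = v := s'.unique_diag s.rotate.rotate.rotate.reflect
      exact hr.2 ⟨_, t', hc⟩

/-- The path `q` is obtained from `p` by moving the starting point along an edge. -/
def Shift (X : CubeComplex V) {o u v : V} (h : X.edgeGraph.Adj u v) (p : X.edgeGraph.Walk u o)
    (q : X.edgeGraph.Walk v o) : Prop :=
  X.SwapEq p (.cons h q) ∨ X.SwapEq q (.cons h.symm p)

theorem Shift.symm {u v : V} {h : X.edgeGraph.Adj u v} {p : X.edgeGraph.Walk u o}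
    {q : X.edgeGraph.Walk v o} (hpq : X.Shift h p q) : X.Shift h.symm q p :=
  Or.symm hpq

theorem Shift.congr {u v : V} {h : X.edgeGraph.Adj u v} {p p' : X.edgeGraph.Walk u o}
    {q q' : X.edgeGraph.Walk v o} (hpq : X.Shift h p q) (hp : X.SwapEq p p')
    (hq : X.SwapEq q q') : X.Shift h p' q' := by
  rcases hpq with hpq | hpq
  · exact Or.inl (hp.symm.trans (hpq.trans (.cons _ hq)))
  · exact Or.inr (hq.symm.trans (hpq.trans (.cons _ hp)))

/-- When both shifts shorten `p`, cancel the edge; when both lengthen it, the results agree. In the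
mixed cases one of `q`, `q'` would backtrack. -/
theorem Shift.unique (hX : X.LinkCondition) {u v : V} {h : X.edgeGraph.Adj u v}
    {p : X.edgeGraph.Walk u o} {q q' : X.edgeGraph.Walk v o} (hq : X.IsReduced q)
    (hq' : X.IsReduced q') (hpq : X.Shift h p q) (hpq' : X.Shift h p q') : X.SwapEq q q' := by
  rcases hpq with hpq | hpq <;> rcases hpq' with hpq' | hpq'
  · exact (hpq.symm.trans hpq').of_cons hX
  · exact absurd ⟨_, _, hpq⟩ (hq'.swapEq hX hpq').2
  · exact absurd ⟨_, _, hpq'⟩ (hq.swapEq hX hpq).2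
  · exact hpq.trans hpq'.symm

theorem Shift.exists (hX : X.LinkCondition) {u v : V} (h : X.edgeGraph.Adj u v)
    {p : X.edgeGraph.Walk u o} (hp : X.IsReduced p) : ∃ q, X.IsReduced q ∧ X.Shift h p q := by
  by_cases hq : ∃ (h' : X.edgeGraph.Adj u v) (q : X.edgeGraph.Walk v o), X.SwapEq p (.cons h' q)
  · obtain ⟨h', q, hq⟩ := hq
    exact ⟨q, (hp.swapEq hX hq).1, Or.inl hq⟩
  · exact ⟨.cons h.symm p, ⟨hp, hq⟩, Or.inr (.refl _)⟩

/-- Shifting along two consecutive edges of a square agrees with shifting along the others. -/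
theorem Shift.sq (hX : X.LinkCondition) {u a w b : V} (s : X.Sq u a w b)
    {p : X.edgeGraph.Walk u o} {q : X.edgeGraph.Walk a o} {r : X.edgeGraph.Walk w o}
    (hp : X.IsReduced p) (hr : X.IsReduced r)
    (hpq : X.Shift s.ab p q) (hqr : X.Shift s.bc q r) :
    ∃ t, X.IsReduced t ∧ X.Shift s.da.symm p t ∧ X.Shift s.cd.symm t r := by
  -- The cases record whether each shift shortens (`Or.inl`) or lengthens (`Or.inr`) the path. If
  -- both do the same, one swap suffices; shortening then lengthening requires a reducedness check,
  -- and lengthening then shortening is the diamond lemma at `a`.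
  rcases hpq with hpq | hpq <;> rcases hqr with hqr | hqr
  · have key := hpq.trans ((SwapEq.cons _ hqr).trans (SwapEq.swap s r))
    exact ⟨_, (hp.swapEq hX key).1, Or.inl key, Or.inl (.refl _)⟩
  · refine ⟨.cons s.da p, ⟨hp, ?_⟩, Or.inr (.refl _), Or.inl ?_⟩
    · rintro ⟨h', t, ht⟩
      obtain ⟨c, s', t', hc, -⟩ := (hpq.symm.trans ht).exists_sq hX s.bd
      obtain rfl := s'.unique_diag s
      exact (hr.swapEq hX hqr).2 ⟨_, _, hc⟩
    · exact (SwapEq.cons _ hpq).trans ((SwapEq.swap s.rotate.rotate.rotate q).trans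
        (.cons _ hqr.symm))
  · obtain ⟨c, s', t, ht, ht'⟩ := (hpq.symm.trans hqr).exists_sq hX s.ac
    obtain rfl := s'.unique_diag s.rotate.reflect
    exact ⟨t, (hp.swapEq hX ht).1, Or.inl ht, Or.inr ht'⟩
  · have key := hqr.trans ((SwapEq.cons _ hpq).trans (SwapEq.swap s.rotate.rotate.reflect p))
    exact ⟨_, (hr.swapEq hX key).1, Or.inr (.refl _), Or.inr key⟩

end traces

end CubeComplex

namespace CubeComplex

/-! ### Extending edge data to cocycles on cubes -/

section cocycles

variable {V : Type*} {X : CubeComplex V} {G : Type*} [Group G]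

/-- On the graph of the standard cube, a function on the oriented edges whose products around
squares are trivial is a coboundary. -/
theorem exists_potential_of_square {n : ℕ} (τ : (Fin n → Bool) → Fin n → G)
    (hinv : ∀ x i, τ (flipAt x i) i * τ x i = 1)
    (hsq : ∀ x i j, i ≠ j → τ (flipAt x i) j * τ x i = τ (flipAt x j) i * τ x j) :
    ∃ k : (Fin n → Bool) → G, ∀ x i, k (flipAt x i) = τ x i * k x := by
  suffices H : ∀ s : Finset (Fin n), ∃ k : (Fin n → Bool) → G, ∀ x, ∀ i ∈ s,
      k (flipAt x i) = τ x i * k x by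
    obtain ⟨k, hk⟩ := H Finset.univ
    exact ⟨k, fun x i => hk x i (Finset.mem_univ i)⟩
  intro s
  induction s using Finset.induction_on with
  | empty => exact ⟨1, by simp⟩
  | insert j s hj ih =>
    obtain ⟨k, hk⟩ := ih
    -- The old potential is kept on the facet `x j = false` and transported by `τ` across direction
    -- `j` to the opposite facet.
    refine ⟨fun x => if x j = true then τ (flipAt x j) j * k (flipAt x j) else k x,
      fun x i hi => ?_⟩
    by_cases hij : i = j
    · subst hij
      cases hx : x i
      · simp [hx]
      · simp [hx, ← mul_assoc, by simpa using hinv (flipAt x i) i]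
    · have his : i ∈ s := (Finset.mem_insert.1 hi).resolve_left hij
      simp only [flipAt_of_ne x (Ne.symm hij)]
      split_ifs with hx
      · rw [flipAt_comm, hk _ i his, ← mul_assoc, ← mul_assoc, hsq _ i j hij, flipAt_flipAt]
      · exact hk x i his

/-- `k` is a potential on the cube `C` for the function `τ` on oriented edges. -/
def IsPotential (X : CubeComplex V) (τ : V → V → G) (C : Set V) (k : V → G) : Prop :=
  ∀ u ∈ C, ∀ v ∈ C, X.edgeGraph.Adj u v → k v = τ u v * k u

theorem exists_isPotential {τ : V → V → G}
    (hinv : ∀ u v, X.edgeGraph.Adj u v → τ v u * τ u v = 1)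
    (hsq : ∀ u a w b, X.Sq u a w b → τ a w * τ u a = τ b w * τ u b)
    {C : Set V} (hC : C ∈ X.cubes) : ∃ k, X.IsPotential τ C k := by
  obtain ⟨n, φ, rfl, hφ⟩ := X.exists_chart C hC
  obtain ⟨k, hk⟩ := exists_potential_of_square (fun x i => τ (φ x) (φ (flipAt x i)))
    (fun x i => by simpa using hinv _ _ (adj_flipAt hφ x i))
    (fun x i j hij => by
      have := hsq _ _ _ _ (Sq.of_chart hφ x hij)
      rwa [flipAt_comm x j i])
  refine ⟨fun v => k (Function.invFun φ v), ?_⟩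
  rintro _ ⟨x, rfl⟩ v hv huv
  obtain ⟨i, rfl⟩ := exists_flipAt_of_adj hφ hv huv
  simp only [Function.leftInverse_invFun hφ.1 _, hk]

/-- The quotient `k'⁻¹ k` is constant along the edges of the cube, hence constant. -/
theorem IsPotential.eq {τ : V → V → G} {C : Set V} (hC : C ∈ X.cubes) {k k' : V → G}
    (hk : X.IsPotential τ C k) (hk' : X.IsPotential τ C k') {u v : V} (hu : u ∈ C) (hv : v ∈ C) :
    k v * (k u)⁻¹ = k' v * (k' u)⁻¹ := by
  obtain ⟨n, φ, rfl, hφ⟩ := X.exists_chart C hC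
  obtain ⟨x, rfl⟩ := hu
  obtain ⟨y, rfl⟩ := hv
  have h : (k' (φ x))⁻¹ * k (φ x) = (k' (φ y))⁻¹ * k (φ y) :=
    eq_of_flipAt_eq (fun x => (k' (φ x))⁻¹ * k (φ x)) (fun x i => by
      rw [hk _ ⟨x, rfl⟩ _ ⟨_, rfl⟩ (adj_flipAt hφ x i),
        hk' _ ⟨x, rfl⟩ _ ⟨_, rfl⟩ (adj_flipAt hφ x i)]
      group) x y
  rw [inv_mul_eq_iff_eq_mul, ← mul_assoc] at h
  rw [h]
  group

/-- A function on oriented edges that is trivial around squares extends to a cocycle on the pairs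
of vertices contained in a common cube. -/
theorem exists_cocycle {τ : V → V → G}
    (hinv : ∀ u v, X.edgeGraph.Adj u v → τ v u * τ u v = 1)
    (hsq : ∀ u a w b, X.Sq u a w b → τ a w * τ u a = τ b w * τ u b) :
    ∃ g : V → V → G, (∀ u v, X.edgeGraph.Adj u v → g u v = τ u v) ∧
      ∀ C ∈ X.cubes, ∃ k : V → G, ∀ u ∈ C, ∀ v ∈ C, g u v = k v * (k u)⁻¹ := by
  classical
  choose k hk using fun C : X.cubes => exists_isPotential hinv hsq C.2
  let g : V → V → G := fun u v => if h : ∃ C : X.cubes, u ∈ C.1 ∧ v ∈ C.1 then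
    k h.choose v * (k h.choose u)⁻¹ else 1
  have hg : ∀ C ∈ X.cubes, ∀ k', X.IsPotential τ C k' → ∀ u ∈ C, ∀ v ∈ C,
      g u v = k' v * (k' u)⁻¹ := by
    intro C hC k' hk' u hu v hv
    have h : ∃ C : X.cubes, u ∈ C.1 ∧ v ∈ C.1 := ⟨⟨C, hC⟩, hu, hv⟩
    simp only [g, dif_pos h]
    -- Independence of the chosen cube: both potentials restrict to the intersection, which is again
    -- a cube.
    refine IsPotential.eq (X.inter_mem _ hC _ h.choose.2 ⟨u, hu, h.choose_spec.1⟩)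
      (τ := τ) (fun a ha b hb => ?_) (fun a ha b hb => ?_) ⟨hu, h.choose_spec.1⟩
      ⟨hv, h.choose_spec.2⟩
    · exact hk _ a ha.2 b hb.2
    · exact hk' a ha.1 b hb.1
  refine ⟨g, fun u v huv => ?_, fun C hC => ⟨k ⟨C, hC⟩, hg C hC _ (hk ⟨C, hC⟩)⟩⟩
  rw [hg _ huv.2 _ (hk ⟨_, huv.2⟩) u (by simp) v (by simp),
    hk ⟨_, huv.2⟩ u (by simp) v (by simp) huv, mul_inv_cancel_right]

end cocycles

/-! ### Open stars of vertices in the realization -/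

section realization

variable {V : Type*} {X : CubeComplex V}

theorem Cell.continuous_charMap (c : X.Cell) : Continuous c.charMap :=
  continuous_iff_coinduced_le.2 (le_iSup (fun c : X.Cell =>
    TopologicalSpace.coinduced c.charMap inferInstance) c)

theorem isOpen_realization_iff {U : Set X.Realization} :
    IsOpen U ↔ ∀ c : X.Cell, IsOpen (c.charMap ⁻¹' U) := by
  refine isOpen_iSup_iff.trans (forall_congr' fun c => isOpen_coinduced)

theorem Cell.weight_vertex (c : X.Cell) (t : Fin c.dim → unitInterval) (x : Fin c.dim → Bool) :
    c.weight t (c.vertex x) = ∏ i, (if x i = true then (t i : ℝ) else 1 - (t i : ℝ)) := by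
  classical
  unfold Cell.weight
  rw [Finset.sum_eq_single x]
  · simp
  · intro y _ hy
    rw [if_neg fun h => hy (c.isChart.1 h)]
  · simp

theorem Cell.weight_of_notMem (c : X.Cell) (t : Fin c.dim → unitInterval) {v : V}
    (hv : v ∉ Set.range c.vertex) : c.weight t v = 0 := by
  classical
  unfold Cell.weight
  exact Finset.sum_eq_zero fun x _ => if_neg fun h => hv ⟨x, h⟩

theorem exists_cell {C : Set V} (hC : C ∈ X.cubes) : ∃ c : X.Cell, Set.range c.vertex = C := by
  obtain ⟨n, φ, h, hφ⟩ := X.exists_chart C hC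
  exact ⟨⟨n, φ, hφ⟩, h⟩

/-- The open star of a vertex. -/
def star (X : CubeComplex V) (v : V) : Set X.Realization := {w | w.1 v ≠ 0}

theorem isOpen_star (v : V) : IsOpen (X.star v) := by
  refine isOpen_realization_iff.2 fun c => ?_
  have : Continuous fun t => c.weight t v := by
    unfold Cell.weight
    refine continuous_finsetSum _ fun x _ => ?_
    split_ifs
    · refine continuous_finsetProd _ fun i _ => ?_
      split_ifs <;> fun_prop
    · exact continuous_const
  exact isOpen_ne.preimage this

theorem exists_mem_star (w : X.Realization) : ∃ v, w ∈ X.star v := by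
  classical
  obtain ⟨_, c, t, rfl⟩ := w
  refine ⟨c.vertex fun i => decide ((t i : ℝ) ≠ 0), ?_⟩
  change c.weight t _ ≠ 0
  rw [c.weight_vertex, Finset.prod_ne_zero_iff]
  intro i _
  by_cases h : (t i : ℝ) = 0 <;> simp [h]

/-- Stars meet only within a common cube, so a cocycle on such pairs of vertices provides transition
functions for the cover by stars. -/
theorem exists_cube_of_mem_star (w : X.Realization) : ∃ C ∈ X.cubes, ∀ v, w ∈ X.star v → v ∈ C := by
  obtain ⟨_, c, t, rfl⟩ := w
  refine ⟨_, range_mem_cubes c.isChart, fun v hv => ?_⟩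
  by_contra h
  exact hv (c.weight_of_notMem t h)

/-- The point of the straight segment from the corner `x` to the corner `y` of `[0,1]ⁿ`. -/
def segment {n : ℕ} (x y : Fin n → Bool) (s : unitInterval) (i : Fin n) : unitInterval :=
  if x i = y i then (if x i = true then 1 else 0)
  else if y i = true then s else unitInterval.symm s

theorem continuous_segment {n : ℕ} (x y : Fin n → Bool) : Continuous (segment x y) := by
  refine continuous_pi fun i => ?_
  unfold segment
  split_ifs <;> fun_prop

theorem weight_segment_left (c : X.Cell) (x y : Fin c.dim → Bool) {s : unitInterval} (hs : s ≠ 1) :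
    c.weight (segment x y s) (c.vertex x) ≠ 0 := by
  have hs' : 1 - (s : ℝ) ≠ 0 := fun h => hs (Subtype.ext (by simpa using (sub_eq_zero.1 h).symm))
  rw [c.weight_vertex, Finset.prod_ne_zero_iff]
  intro i _
  unfold segment
  cases x i <;> cases y i <;> simp [hs']

theorem weight_segment_right (c : X.Cell) (x y : Fin c.dim → Bool) {s : unitInterval} (hs : s ≠ 0) :
    c.weight (segment x y s) (c.vertex y) ≠ 0 := by
  have hs' : (s : ℝ) ≠ 0 := fun h => hs (Subtype.ext (by simpa using h))
  rw [c.weight_vertex, Finset.prod_ne_zero_iff]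
  intro i _
  unfold segment
  cases x i <;> cases y i <;> simp [hs']

/-- The corner `x` of `[0,1]ⁿ`. -/
def corner {n : ℕ} (x : Fin n → Bool) (i : Fin n) : unitInterval := if x i = true then 1 else 0

theorem Cell.weight_corner (c : X.Cell) (x : Fin c.dim → Bool) :
    c.weight (corner x) = Function.extend (fun _ : Unit => c.vertex x) 1 0 := by
  funext v
  have hinj : Function.Injective fun _ : Unit => c.vertex x := fun _ _ _ => rfl
  by_cases hv : v ∈ Set.range c.vertex
  · obtain ⟨y, rfl⟩ := hv
    rw [c.weight_vertex]
    by_cases hxy : y = x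
    · subst hxy
      rw [hinj.extend_apply 1 0 ()]
      refine Finset.prod_eq_one fun i _ => ?_
      unfold corner
      cases y i <;> simp
    · rw [Function.extend_apply' _ _ _ fun ⟨_, h⟩ => hxy (c.isChart.1 h).symm]
      obtain ⟨i, hi⟩ := Function.ne_iff.1 hxy
      refine Finset.prod_eq_zero (Finset.mem_univ i) ?_
      unfold corner
      revert hi
      cases y i <;> cases x i <;> simp
  · rw [c.weight_of_notMem _ hv, Function.extend_apply' _ _ _ fun ⟨_, h⟩ => hv ⟨x, h⟩]
    rfl

/-- The point of the realization given by a vertex. -/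
noncomputable def vertexPoint (X : CubeComplex V) (v : V) : X.Realization :=
  ⟨Function.extend (fun _ : Unit => v) 1 0, by
    obtain ⟨c, hc⟩ := X.exists_cell (X.singleton_mem v)
    obtain ⟨x, hx⟩ : v ∈ Set.range c.vertex := by simp [hc]
    exact ⟨c, corner x, by rw [c.weight_corner, hx]⟩⟩

theorem Cell.charMap_corner (c : X.Cell) (x : Fin c.dim → Bool) :
    c.charMap (corner x) = X.vertexPoint (c.vertex x) :=
  Subtype.ext (c.weight_corner x)

theorem vertexPoint_mem_star (v : V) : X.vertexPoint v ∈ X.star v := by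
  have hinj : Function.Injective fun _ : Unit => v := fun _ _ _ => rfl
  change Function.extend (fun _ : Unit => v) 1 0 v ≠ (0 : ℝ)
  rw [hinj.extend_apply 1 0 ()]
  simp

theorem exists_edgePath {u v : V} (h : X.edgeGraph.Adj u v) :
    ∃ γ : Path (X.vertexPoint u) (X.vertexPoint v),
      (∀ s, s ≠ 1 → γ s ∈ X.star u) ∧ ∀ s, s ≠ 0 → γ s ∈ X.star v := by
  obtain ⟨c, hc⟩ := X.exists_cell h.2
  obtain ⟨x, rfl⟩ : u ∈ Set.range c.vertex := by simp [hc]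
  obtain ⟨y, rfl⟩ : v ∈ Set.range c.vertex := by simp [hc]
  refine ⟨⟨⟨fun s => c.charMap (segment x y s), c.continuous_charMap.comp
    (continuous_segment x y)⟩, ?_, ?_⟩, fun s hs => weight_segment_left c x y hs,
    fun s hs => weight_segment_right c x y hs⟩
  · rw [← c.charMap_corner]
    refine congrArg c.charMap (funext fun i => ?_)
    unfold segment corner
    cases x i <;> cases y i <;> simp
  · rw [← c.charMap_corner]
    refine congrArg c.charMap (funext fun i => ?_)
    unfold segment corner
    cases x i <;> cases y i <;> simp

theorem reachable_of_mem_cube {C : Set V} (hC : C ∈ X.cubes) {u v : V} (hu : u ∈ C) (hv : v ∈ C) :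
    X.edgeGraph.Reachable u v := by
  obtain ⟨n, φ, rfl, hφ⟩ := X.exists_chart C hC
  obtain ⟨x, rfl⟩ := hu
  obtain ⟨y, rfl⟩ := hv
  exact SimpleGraph.ConnectedComponent.exact <| eq_of_flipAt_eq
    (fun x => X.edgeGraph.connectedComponentMk (φ x)) (fun x i =>
      SimpleGraph.ConnectedComponent.sound (adj_flipAt hφ x i).symm.reachable) x y

/-- The edge component of the vertices whose stars contain `w` is a locally constant function of
`w`. -/
theorem edgeGraph_connected [PathConnectedSpace X.Realization] : X.edgeGraph.Connected := by
  choose σ hσ using exists_mem_star (X := X)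
  have key : ∀ w v, w ∈ X.star v → X.edgeGraph.connectedComponentMk (σ w) =
      X.edgeGraph.connectedComponentMk v := fun w v hv => by
    obtain ⟨C, hC, h⟩ := exists_cube_of_mem_star w
    exact SimpleGraph.ConnectedComponent.sound (reachable_of_mem_cube hC (h _ (hσ w)) (h _ hv))
  have hloc : IsLocallyConstant fun w => X.edgeGraph.connectedComponentMk (σ w) :=
    (IsLocallyConstant.iff_exists_open _).2 fun w =>
      ⟨X.star (σ w), isOpen_star _, hσ w, fun w' hw' => key w' _ hw'⟩
  refine { preconnected := fun u v => ?_, nonempty := ?_ }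
  · have := hloc.apply_eq_of_preconnectedSpace (X.vertexPoint u) (X.vertexPoint v)
    simp only [key _ _ (vertexPoint_mem_star _)] at this
    exact SimpleGraph.ConnectedComponent.exact this
  · exact (inferInstance : Nonempty X.Realization).map σ

end realization

end CubeComplex

namespace CubeComplex

/-! ### Sections of local systems from simple connectivity -/

section covering

variable {V : Type*} {X : CubeComplex V}

/-- The bundle over the realization with transition functions given by a cocycle of permutations
on the pairs of vertices in a common cube. -/
noncomputable def cocycleBundle (X : CubeComplex V) {F : Type*} [TopologicalSpace F]
    [DiscreteTopology F] (g : V → V → Equiv.Perm F)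
    (hg : ∀ C ∈ X.cubes, ∃ k : V → Equiv.Perm F, ∀ u ∈ C, ∀ v ∈ C, g u v = k v * (k u)⁻¹) :
    FiberBundleCore V X.Realization F where
  baseSet := X.star
  isOpen_baseSet := isOpen_star
  indexAt w := (exists_mem_star w).choose
  mem_baseSet_at w := (exists_mem_star w).choose_spec
  coordChange u v _ := g u v
  coordChange_self u w hw f := by
    obtain ⟨k, hk⟩ := hg _ (X.singleton_mem u)
    simp [hk u rfl u rfl]
  continuousOn_coordChange u v :=
    ((continuous_of_discreteTopology (f := g u v)).comp continuous_snd).continuousOn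
  coordChange_comp u v w x hx f := by
    obtain ⟨C, hC, h⟩ := exists_cube_of_mem_star x
    obtain ⟨k, hk⟩ := hg C hC
    have hu := h u hx.1.1
    have hv := h v hx.1.2
    have hw := h w hx.2
    simp [hk u hu v hv, hk v hv w hw, hk u hu w hw]

/-- Along a path in the total space, the coordinate in the chart of `v` is locally constant. -/
theorem localTriv_snd_eq {F : Type*} [TopologicalSpace F] [DiscreteTopology F]
    {Z : FiberBundleCore V X.Realization F} {Γ : unitInterval → Z.TotalSpace}
    (hΓ : Continuous Γ) {v : V} {I : Set unitInterval} (hI : IsPreconnected I)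
    (hv : ∀ s ∈ I, (Γ s).1 ∈ Z.baseSet v) {s t : unitInterval} (hs : s ∈ I) (ht : t ∈ I) :
    (Z.localTriv v (Γ s)).2 = (Z.localTriv v (Γ t)).2 := by
  refine hI.constant (f := fun s => (Z.localTriv v (Γ s)).2) ?_ hs ht
  refine continuous_snd.comp_continuousOn ((Z.localTriv v).continuousOn.comp hΓ.continuousOn ?_)
  exact fun s hs => (Z.mem_localTriv_source v _).2 (hv s hs)

/-- On a simply connected complex a cocycle of permutations has a section through every value. -/
theorem exists_section_of_cocycle [SimplyConnectedSpace X.Realization] {F : Type*}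
    (g : V → V → Equiv.Perm F)
    (hg : ∀ C ∈ X.cubes, ∃ k : V → Equiv.Perm F, ∀ u ∈ C, ∀ v ∈ C, g u v = k v * (k u)⁻¹)
    (o : V) (f₀ : F) :
    ∃ N : V → F, N o = f₀ ∧ ∀ u v, X.edgeGraph.Adj u v → g u v (N u) = N v := by
  let : TopologicalSpace F := ⊥
  have : DiscreteTopology F := ⟨rfl⟩
  let Z := X.cocycleBundle g hg
  have cov : IsCoveringMap (Z.proj) := FiberBundle.isCoveringMap
  have hmem (v : V) : X.vertexPoint v ∈ Z.baseSet v := vertexPoint_mem_star v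
  let P (u v : V) : Path.Homotopic.Quotient (X.vertexPoint u) (X.vertexPoint v) :=
    .mk (PathConnectedSpace.somePath _ _)
  have hsub {x y : X.Realization} (p q : Path.Homotopic.Quotient x y) : p = q :=
    Subsingleton.elim _ _
  let e₀ : Z.proj ⁻¹' {X.vertexPoint o} :=
    ⟨(Z.localTriv o).toOpenPartialHomeomorph.symm (X.vertexPoint o, f₀), rfl⟩
  refine ⟨fun v => (Z.localTriv v (cov.monodromy (P o v) e₀).1).2, ?_, fun u v huv => ?_⟩
  · beta_reduce
    rw [hsub (P o o) (.refl _), cov.monodromy_refl]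
    change (Z.localTriv o ((Z.localTriv o).toOpenPartialHomeomorph.symm (X.vertexPoint o, f₀))).2
      = f₀
    rw [(Z.localTriv o).apply_symm_apply' (hmem o)]
  · obtain ⟨γ, hγu, hγv⟩ := exists_edgePath huv
    beta_reduce
    -- By simple connectivity the chosen path to `v` may be replaced by the one through `u` and
    -- along the edge.
    rw [hsub (P o v) ((P o u).trans (.mk γ)), cov.monodromy_trans_apply]
    set e := cov.monodromy (P o u) e₀
    let Γ := cov.liftPath γ e.1 (γ.source.trans e.2.symm)
    have hΓ0 : Γ 0 = e.1 := cov.liftPath_zero ..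
    have hΓ1 : Γ 1 = (cov.monodromy (.mk γ) e).1 := rfl
    have hΓ (s) : (Γ s).1 = γ s := congrFun (cov.liftPath_lifts γ e.1 _) s
    have hu : ∀ s ∈ Set.Iio (1 : unitInterval), (Γ s).1 ∈ Z.baseSet u := fun s hs => by
      rw [hΓ]
      exact hγu s (ne_of_lt hs)
    have hv : ∀ s ∈ Set.Ioi (0 : unitInterval), (Γ s).1 ∈ Z.baseSet v := fun s hs => by
      rw [hΓ]
      exact hγv s (ne_of_gt hs)
    -- The midpoint of the edge lies in both stars: the lift is constant in the chart of `u` up to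
    -- it and in the chart of `v` from it on, so the coordinate change there compares the ends.
    let m : unitInterval := ⟨1 / 2, by norm_num, by norm_num⟩
    have hm0 : 0 < m := by
      rw [← Subtype.coe_lt_coe]
      norm_num [m]
    have hm1 : m < 1 := by
      rw [← Subtype.coe_lt_coe]
      norm_num [m]
    have h0 := localTriv_snd_eq Γ.continuous (Set.ordConnected_Iio.isPreconnected) hu
      (s := 0) (t := m) (hm0.trans hm1) hm1
    have h1 := localTriv_snd_eq Γ.continuous (Set.ordConnected_Ioi.isPreconnected) hv
      (s := m) (t := 1) hm0 (hm0.trans hm1)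
    rw [← hΓ0, ← hΓ1, h0, ← h1]
    exact Z.coordChange_comp _ u v _ ⟨⟨Z.mem_baseSet_at _, hu m hm1⟩, hv m hm0⟩ _

/-- On a simply connected complex, a local system on the edge graph that is trivial around squares
has a section through every value. -/
theorem exists_section [SimplyConnectedSpace X.Realization] {F : V → Type*}
    (T : ∀ u v, X.edgeGraph.Adj u v → F u ≃ F v)
    (hinv : ∀ u v (h : X.edgeGraph.Adj u v) f, T v u h.symm (T u v h f) = f)
    (hsq : ∀ u a w b (s : X.Sq u a w b) f,
      T a w s.bc (T u a s.ab f) = T b w s.cd.symm (T u b s.da.symm f)) (o : V) (f₀ : F o) :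
    ∃ N : ∀ v, F v, N o = f₀ ∧ ∀ u v (h : X.edgeGraph.Adj u v), T u v h (N u) = N v := by
  classical
  -- Transport along any edge path identifies each fibre with `F o`, turning the local system into
  -- permutations of one set.
  have hne : ∀ v, Nonempty (F v ≃ F o) := fun v => by
    obtain ⟨p⟩ := X.edgeGraph_connected.preconnected v o
    clear f₀
    induction p with
    | nil => exact ⟨Equiv.refl _⟩
    | cons h _ ih => exact ih.map fun e => (T _ _ h).trans e
  let b : ∀ v, F v ≃ F o := fun v => (hne v).some
  let τ : V → V → Equiv.Perm (F o) := fun u v =>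
    if h : X.edgeGraph.Adj u v then (b u).symm.trans ((T u v h).trans (b v)) else 1
  have hτ : ∀ u v (h : X.edgeGraph.Adj u v) f, τ u v f = b v (T u v h ((b u).symm f)) :=
    fun u v h f => by simp [τ, h]
  obtain ⟨g, hgτ, hg⟩ := X.exists_cocycle (τ := τ)
    (fun u v h => Equiv.ext fun f => by simp [hτ u v h, hτ v u h.symm, hinv])
    (fun u a w b s => Equiv.ext fun f => by
      simp [hτ _ _ s.ab, hτ _ _ s.bc, hτ _ _ s.da.symm, hτ _ _ s.cd.symm, hsq u a w b s])
  obtain ⟨N, hN₀, hN⟩ := X.exists_section_of_cocycle g hg o (b o f₀)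
  refine ⟨fun v => (b v).symm (N v), by simp [hN₀], fun u v h => ?_⟩
  beta_reduce
  rw [← hN u v h, hgτ u v h, hτ u v h, Equiv.symm_apply_apply]

end covering

end CubeComplex

namespace CubeComplex

/-! ### Uniqueness of reduced paths, and quadrangles -/

section geodesics

variable {V : Type*} {X : CubeComplex V}

/-- Swap-equivalence of reduced paths from `v` to `o`. -/
def reducedSetoid (X : CubeComplex V) (o v : V) :
    Setoid {p : X.edgeGraph.Walk v o // X.IsReduced p} where
  r p q := X.SwapEq p.1 q.1
  iseqv := ⟨fun p => .refl p.1, .symm, .trans⟩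

/-- The swap-equivalence classes of reduced paths from `v` to `o`. -/
def ReducedClass (X : CubeComplex V) (o v : V) := Quotient (X.reducedSetoid o v)

/-- Moving the starting point of a class of reduced paths along an edge. -/
noncomputable def shiftClass (hX : X.LinkCondition) (o : V) {u v : V} (h : X.edgeGraph.Adj u v) :
    X.ReducedClass o u → X.ReducedClass o v :=
  Quotient.lift (fun p => Quotient.mk (X.reducedSetoid o v) ⟨(Shift.exists hX h p.2).choose,
    (Shift.exists hX h p.2).choose_spec.1⟩) fun p q hpq =>
      Quotient.sound (s := X.reducedSetoid o v) <|
        Shift.unique hX (Shift.exists hX h p.2).choose_spec.1 (Shift.exists hX h q.2).choose_spec.1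
          ((Shift.exists hX h p.2).choose_spec.2.congr hpq (.refl _))
          (Shift.exists hX h q.2).choose_spec.2

theorem shiftClass_mk_eq (hX : X.LinkCondition) {o u v : V} {h : X.edgeGraph.Adj u v}
    {p : X.edgeGraph.Walk u o} {q : X.edgeGraph.Walk v o} (hp : X.IsReduced p)
    (hq : X.IsReduced q) :
    shiftClass hX o h (Quotient.mk _ ⟨p, hp⟩) = Quotient.mk _ ⟨q, hq⟩ ↔ X.Shift h p q := by
  refine (Quotient.eq (r := X.reducedSetoid o v)).trans ⟨fun e => ?_, fun e => ?_⟩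
  · exact (Shift.exists hX h hp).choose_spec.2.congr (.refl _) e
  · exact Shift.unique hX (Shift.exists hX h hp).choose_spec.1 hq
      (Shift.exists hX h hp).choose_spec.2 e

theorem shiftClass_shiftClass (hX : X.LinkCondition) {o u v : V} (h : X.edgeGraph.Adj u v)
    (f : X.ReducedClass o u) : shiftClass hX o h.symm (shiftClass hX o h f) = f := by
  induction f using Quotient.inductionOn with
  | _ p =>
    obtain ⟨q, hq, hpq⟩ := Shift.exists hX h p.2
    rw [(shiftClass_mk_eq hX p.2 hq).2 hpq, (shiftClass_mk_eq hX hq p.2).2 hpq.symm]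

theorem shiftClass_sq (hX : X.LinkCondition) {o u a w b : V} (s : X.Sq u a w b)
    (f : X.ReducedClass o u) : shiftClass hX o s.bc (shiftClass hX o s.ab f) =
      shiftClass hX o s.cd.symm (shiftClass hX o s.da.symm f) := by
  induction f using Quotient.inductionOn with
  | _ p =>
    obtain ⟨q, hq, hpq⟩ := Shift.exists hX s.ab p.2
    obtain ⟨r, hr, hqr⟩ := Shift.exists hX s.bc hq
    obtain ⟨t, ht, hpt, htr⟩ := Shift.sq hX s p.2 hr hpq hqr
    rw [(shiftClass_mk_eq hX p.2 hq).2 hpq, (shiftClass_mk_eq hX hq hr).2 hqr,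
      (shiftClass_mk_eq hX p.2 ht).2 hpt, (shiftClass_mk_eq hX ht hr).2 htr]

/-- In a CAT(0) cube complex there is a reduced path from every vertex to `o`, unique up to swaps,
and the reduced paths from adjacent vertices differ by a shift. -/
theorem IsCAT0.exists_reduced (hX : X.IsCAT0) (o : V) : ∃ N : ∀ v, X.edgeGraph.Walk v o,
    (∀ v, X.IsReduced (N v)) ∧ (∀ u v (h : X.edgeGraph.Adj u v), X.Shift h (N u) (N v)) ∧
      ∀ v p, X.IsReduced p → X.SwapEq p (N v) := by
  have := hX.simplyConnected
  have hL := hX.linkCondition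
  obtain ⟨N, hN₀, hN⟩ := X.exists_section (F := X.ReducedClass o)
    (fun u v h => ⟨shiftClass hL o h, shiftClass hL o h.symm, shiftClass_shiftClass hL h,
      shiftClass_shiftClass hL h.symm⟩) (fun u v h f => shiftClass_shiftClass hL h f)
    (fun u a w b s f => shiftClass_sq hL s f) o (Quotient.mk _ ⟨.nil, trivial⟩)
  have hout : ∀ v, Quotient.mk _ (Quotient.out (N v)) = N v := fun v => Quotient.out_eq _
  have hS : ∀ u v (h : X.edgeGraph.Adj u v),
      X.Shift h (Quotient.out (N u)).1 (Quotient.out (N v)).1 := fun u v h =>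
    (shiftClass_mk_eq hL (Quotient.out (N u)).2 (Quotient.out (N v)).2).1
      (by rw [hout, hout]; exact hN u v h)
  refine ⟨fun v => (Quotient.out (N v)).1, fun v => (Quotient.out (N v)).2, hS, fun v p hp => ?_⟩
  -- The class through `.nil` settles `o`. Inductively, `p` and the chosen path at its start are
  -- both shifts of the chosen path at its second vertex.
  induction p with
  | nil =>
    have := (hout _).trans hN₀
    exact (Quotient.exact (s := X.reducedSetoid _ _) this).symm
  | cons h p ih =>
    exact Shift.unique hL hp (Quotient.out (N _)).2
      (Shift.congr (p := p) (h := h.symm) (Or.inr (.refl _)) (ih N hN₀ hN hout hS hp.1) (.refl _))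
      (hS _ _ h.symm)

/-- Backtracking would leave a path with the same ends that is shorter by two. -/
theorem IsReduced.of_length_eq_dist (hG : X.edgeGraph.Connected) {v o : V}
    {p : X.edgeGraph.Walk v o} (hp : p.length = X.edgeGraph.dist v o) : X.IsReduced p := by
  induction p with
  | nil => trivial
  | @cons a v o h p ih =>
    have h1 : X.edgeGraph.dist v o ≤ p.length := SimpleGraph.dist_le p
    have h2 : X.edgeGraph.dist a o ≤ 1 + X.edgeGraph.dist v o := by
      have := hG.dist_triangle (u := a) (v := v) (w := o)
      rwa [SimpleGraph.dist_eq_one_iff_adj.2 h] at this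
    rw [SimpleGraph.Walk.length_cons] at hp
    refine ⟨ih (by omega), ?_⟩
    rintro ⟨h', q, hq⟩
    have := hq.length_eq
    rw [SimpleGraph.Walk.length_cons] at this
    have := SimpleGraph.dist_le q
    omega

/-- The two properties of the edge graph of a CAT(0) cube complex from which everything else is
derived: distances to a vertex `o` change along every edge, and two neighbours of `a` that are
closer to `o` than `a` span a square with `a` whose fourth vertex is closer still. -/
structure IsQuadrangular (X : CubeComplex V) : Prop where
  connected : X.edgeGraph.Connected
  dist_ne : ∀ o {u v : V}, X.edgeGraph.Adj u v → X.edgeGraph.dist u o ≠ X.edgeGraph.dist v o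
  exists_sq : ∀ o {a v w : V}, X.edgeGraph.Adj a v → X.edgeGraph.Adj a w → v ≠ w →
    X.edgeGraph.dist v o < X.edgeGraph.dist a o → X.edgeGraph.dist w o < X.edgeGraph.dist a o →
    ∃ b, X.Sq a v b w ∧ X.edgeGraph.dist b o < X.edgeGraph.dist v o

/-- Geodesics are reduced, so the chosen reduced paths have length equal to the distance, and a
shift changes this by exactly one. Two geodesics from `a` through `v` and `w` are swap-equivalent,
so the diamond lemma produces the square. -/
theorem IsCAT0.isQuadrangular (hX : X.IsCAT0) : X.IsQuadrangular := by
  have := hX.simplyConnected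
  have hL := hX.linkCondition
  have hG : X.edgeGraph.Connected := edgeGraph_connected
  have hgeo : ∀ {u v o : V} (h : X.edgeGraph.Adj u v),
      X.edgeGraph.dist v o < X.edgeGraph.dist u o → ∀ p : X.edgeGraph.Walk v o,
      p.length = X.edgeGraph.dist v o → X.IsReduced (.cons h p) := fun {u v o} h hlt p hp => by
    refine IsReduced.of_length_eq_dist hG (le_antisymm ?_ (SimpleGraph.dist_le _))
    rw [SimpleGraph.Walk.length_cons]
    omega
  refine ⟨hG, fun o u v h => ?_, fun o a v w hv hw hvw hlv hlw => ?_⟩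
  · obtain ⟨N, hN, hS, hU⟩ := hX.exists_reduced o
    have hlen : ∀ v, (N v).length = X.edgeGraph.dist v o := fun v => by
      obtain ⟨p, hp⟩ := hG.exists_walk_length_eq_dist v o
      rw [← hp, (hU v p (IsReduced.of_length_eq_dist hG hp)).length_eq]
    rw [← hlen, ← hlen]
    rcases hS u v h with h | h <;> have := h.length_eq <;>
      rw [SimpleGraph.Walk.length_cons] at this <;> omega
  · obtain ⟨N, hN, hS, hU⟩ := hX.exists_reduced o
    obtain ⟨p, hp⟩ := hG.exists_walk_length_eq_dist v o
    obtain ⟨q, hq⟩ := hG.exists_walk_length_eq_dist w o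
    have key := (hU a _ (hgeo hv hlv p hp)).trans (hU a _ (hgeo hw hlw q hq)).symm
    obtain ⟨b, s, r, hr, -⟩ := key.exists_sq hL hvw
    refine ⟨b, s, ?_⟩
    have h1 := hr.length_eq
    rw [SimpleGraph.Walk.length_cons] at h1
    have := SimpleGraph.dist_le r
    omega

end geodesics

end CubeComplex

namespace CubeComplex

/-! ### Halfspaces and separation -/

section halfspaces

variable {V : Type*} {X : CubeComplex V}

/-- The vertices that are closer to `u` than to `v`. -/
def halfspace (X : CubeComplex V) (u v : V) : Set V :=
  {z | X.edgeGraph.dist u z < X.edgeGraph.dist v z}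

theorem mem_halfspace {u v z : V} :
    z ∈ X.halfspace u v ↔ X.edgeGraph.dist u z < X.edgeGraph.dist v z := Iff.rfl

theorem left_mem_halfspace {u v : V} (h : X.edgeGraph.Adj u v) : u ∈ X.halfspace u v := by
  rw [mem_halfspace, SimpleGraph.dist_self, SimpleGraph.dist_eq_one_iff_adj.2 h.symm]
  exact one_pos

theorem right_notMem_halfspace {u v : V} : v ∉ X.halfspace u v := by
  rw [mem_halfspace, SimpleGraph.dist_self]
  omega

/-- The halfspaces that contain `x` but not `y`. -/
def sep (X : CubeComplex V) (x y : V) : Set (Set V) :=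
  {h | (∃ u v, X.edgeGraph.Adj u v ∧ h = X.halfspace u v) ∧ x ∈ h ∧ y ∉ h}

/-- The minimal halfspaces that contain `x` but not `y`. -/
def minSep (X : CubeComplex V) (x y : V) : Set (Set V) :=
  {h | h ∈ X.sep x y ∧ ∀ k ∈ X.sep x y, k ⊆ h → k = h}

/-- The maximal halfspaces that contain `x` but not `y`. -/
def maxSep (X : CubeComplex V) (x y : V) : Set (Set V) :=
  {h | h ∈ X.sep x y ∧ ∀ k ∈ X.sep x y, h ⊆ k → k = h}

namespace IsQuadrangular

theorem dist_le_succ (hX : X.IsQuadrangular) {u v : V} (h : X.edgeGraph.Adj u v) (o : V) :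
    X.edgeGraph.dist u o ≤ X.edgeGraph.dist v o + 1 := by
  have := hX.connected.dist_triangle (u := u) (v := v) (w := o)
  rw [SimpleGraph.dist_eq_one_iff_adj.2 h] at this
  omega

theorem dist_eq_or (hX : X.IsQuadrangular) {u v : V} (h : X.edgeGraph.Adj u v) (o : V) :
    X.edgeGraph.dist u o = X.edgeGraph.dist v o + 1 ∨
      X.edgeGraph.dist v o = X.edgeGraph.dist u o + 1 := by
  have h1 := hX.dist_le_succ h o
  have h2 := hX.dist_le_succ h.symm o
  have h3 := hX.dist_ne o h
  omega

theorem exists_closer (hX : X.IsQuadrangular) {u o : V} (h : u ≠ o) :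
    ∃ v, X.edgeGraph.Adj u v ∧ X.edgeGraph.dist v o < X.edgeGraph.dist u o := by
  obtain ⟨p, hp⟩ := hX.connected.exists_walk_length_eq_dist u o
  cases p with
  | nil => exact absurd rfl h
  | cons h' p =>
    refine ⟨_, h', ?_⟩
    rw [← hp, SimpleGraph.Walk.length_cons]
    exact Nat.lt_succ_of_le (SimpleGraph.dist_le p)

theorem compl_halfspace (hX : X.IsQuadrangular) {u v : V} (h : X.edgeGraph.Adj u v) :
    (X.halfspace u v)ᶜ = X.halfspace v u := by
  ext z
  rw [Set.mem_compl_iff, mem_halfspace, mem_halfspace]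
  have := hX.dist_ne z h
  omega

/-- Otherwise `z` is equally far from `a` and `c`, and one further from `b` and `d`. The quadrangle
property at `b` then gives a square on `a`, `b`, `c`, whose fourth vertex is `d` by uniqueness but
is closer to `z` than `a`. -/
theorem halfspace_subset_of_sq (hX : X.IsQuadrangular) {a b c d : V} (s : X.Sq a b c d) :
    X.halfspace a b ⊆ X.halfspace d c := by
  intro z hz
  rw [mem_halfspace] at hz ⊢
  by_contra hcd
  have h1 := hX.dist_eq_or s.ab z
  have h2 := hX.dist_eq_or s.bc z
  have h3 := hX.dist_eq_or s.cd z
  have h4 := hX.dist_eq_or s.da z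
  obtain ⟨e, s', he⟩ := hX.exists_sq z s.ab.symm s.bc s.ac (by omega) (by omega)
  obtain rfl := s'.unique_diag s.rotate.reflect
  omega

theorem halfspace_eq_of_sq (hX : X.IsQuadrangular) {a b c d : V} (s : X.Sq a b c d) :
    X.halfspace a b = X.halfspace d c :=
  (hX.halfspace_subset_of_sq s).antisymm
    (hX.halfspace_subset_of_sq s.rotate.rotate.rotate.reflect)

/-- An edge leaving a halfspace defines this halfspace. -/
theorem halfspace_eq_of_crossing (hX : X.IsQuadrangular) {u v a b : V}
    (huv : X.edgeGraph.Adj u v) (hab : X.edgeGraph.Adj a b) (ha : a ∈ X.halfspace u v)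
    (hb : b ∉ X.halfspace u v) : X.halfspace a b = X.halfspace u v := by
  suffices H : ∀ n a b, X.edgeGraph.Adj a b → a ∈ X.halfspace u v → b ∉ X.halfspace u v →
      X.edgeGraph.dist a u = n → X.halfspace a b = X.halfspace u v from H _ a b hab ha hb rfl
  clear hab ha hb a b
  intro n
  induction n using Nat.strong_induction_on with
  | _ n ih =>
    intro a b hab ha hb hn
    rw [mem_halfspace, X.edgeGraph.dist_comm (u := u), X.edgeGraph.dist_comm (u := v)] at ha hb
    have h1 := hX.dist_eq_or hab u
    have h2 := hX.dist_eq_or hab v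
    have h3 := hX.dist_eq_or huv a
    have h4 := hX.dist_eq_or huv b
    simp only [X.edgeGraph.dist_comm (u := u), X.edgeGraph.dist_comm (u := v)] at h3 h4
    by_cases hbv : b = v
    · subst hbv
      have : X.edgeGraph.dist a u = 0 := by
        rw [SimpleGraph.dist_self] at h4 h2
        omega
      rw [hX.connected.dist_eq_zero_iff.1 this]
    · obtain ⟨b', hb', hlt⟩ := hX.exists_closer hbv
      have h5 := hX.dist_eq_or hb' v
      have h6 := hX.dist_eq_or hb' u
      have h7 := hX.dist_eq_or huv b'
      simp only [X.edgeGraph.dist_comm (u := u), X.edgeGraph.dist_comm (u := v)] at h7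
      have hne : a ≠ b' := by
        rintro rfl
        omega
      -- Both `a` and `b'` are closer to `u` than `b` is; the resulting square carries the edge `a
      -- b` to the crossing edge `c b'`, with `c` nearer to `u`.
      obtain ⟨c, s, hc⟩ := hX.exists_sq u hab.symm hb' hne (by omega) (by omega)
      have h8 := hX.dist_eq_or s.bc u
      have h9 := hX.dist_eq_or s.bc v
      rw [← ih _ (hn ▸ hc) c b' s.cd _ _ rfl]
      · exact hX.halfspace_eq_of_sq s.rotate.reflect
      · rw [mem_halfspace, X.edgeGraph.dist_comm (u := u), X.edgeGraph.dist_comm (u := v)]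
        omega
      · rw [mem_halfspace, X.edgeGraph.dist_comm (u := u), X.edgeGraph.dist_comm (u := v)]
        omega

theorem eq_of_crossing (hX : X.IsQuadrangular) {x y a b : V} {h : Set V} (hh : h ∈ X.sep x y)
    (hab : X.edgeGraph.Adj a b) (ha : a ∈ h) (hb : b ∉ h) : h = X.halfspace a b := by
  obtain ⟨⟨u, v, huv, rfl⟩, -⟩ := hh
  exact (hX.halfspace_eq_of_crossing huv hab ha hb).symm

theorem sep_self (x : V) : X.sep x x = ∅ :=
  Set.eq_empty_of_forall_notMem fun _ h => h.2.2 h.2.1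

theorem compl_mem_sep (hX : X.IsQuadrangular) {x y : V} {h : Set V} (hh : h ∈ X.sep x y) :
    hᶜ ∈ X.sep y x := by
  obtain ⟨⟨u, v, huv, rfl⟩, hx, hy⟩ := hh
  exact ⟨⟨v, u, huv.symm, hX.compl_halfspace huv⟩, hy, fun h => h hx⟩

theorem halfspace_mem_sep {x y o : V} (h : X.edgeGraph.Adj x y)
    (hlt : X.edgeGraph.dist y o < X.edgeGraph.dist x o) : X.halfspace x y ∈ X.sep x o :=
  ⟨⟨x, y, h, rfl⟩, left_mem_halfspace h, by rw [mem_halfspace]; omega⟩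

/-- A halfspace separating the ends of an edge is one of the two defined by that edge, and
`halfspace y x` contains `o`. Along a geodesic this counts `sep x o`. -/
theorem sep_eq_insert (hX : X.IsQuadrangular) {x y o : V} (h : X.edgeGraph.Adj x y)
    (hlt : X.edgeGraph.dist y o < X.edgeGraph.dist x o) :
    X.sep x o = insert (X.halfspace x y) (X.sep y o) := by
  ext k
  constructor
  · intro hk
    by_cases hy : y ∈ k
    · exact Or.inr ⟨hk.1, hy, hk.2.2⟩
    · exact Or.inl (hX.eq_of_crossing hk h hk.2.1 hy)
  · rintro (rfl | hk)
    · exact halfspace_mem_sep h hlt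
    · refine ⟨hk.1, ?_, hk.2.2⟩
      by_contra hx
      have := hX.eq_of_crossing hk h.symm hk.2.1 hx
      exact hk.2.2 (this ▸ hlt)

theorem halfspace_notMem_sep {x y o : V} : X.halfspace x y ∉ X.sep y o :=
  fun h => right_notMem_halfspace h.2.1

theorem finite_sep_and_ncard (hX : X.IsQuadrangular) (x o : V) :
    (X.sep x o).Finite ∧ (X.sep x o).ncard = X.edgeGraph.dist x o := by
  induction hn : X.edgeGraph.dist x o using Nat.strong_induction_on generalizing x with
  | _ n ih =>
    by_cases hx : x = o
    · subst hx
      rw [SimpleGraph.dist_self] at hn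
      simp [sep_self, ← hn]
    · obtain ⟨y, hxy, hlt⟩ := hX.exists_closer hx
      obtain ⟨hf, hc⟩ := ih _ (hn ▸ hlt) y rfl
      rw [hX.sep_eq_insert hxy hlt, Set.ncard_insert_of_notMem halfspace_notMem_sep hf, hc]
      have := hX.dist_eq_or hxy o
      exact ⟨hf.insert _, by omega⟩

theorem finite_sep (hX : X.IsQuadrangular) (x o : V) : (X.sep x o).Finite :=
  (hX.finite_sep_and_ncard x o).1

theorem ncard_sep (hX : X.IsQuadrangular) (x o : V) :
    (X.sep x o).ncard = X.edgeGraph.dist x o := (hX.finite_sep_and_ncard x o).2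

theorem eq_of_sep_eq_empty (hX : X.IsQuadrangular) {x y : V} (h : X.sep x y = ∅) : x = y := by
  have := hX.ncard_sep x y
  rw [h, Set.ncard_empty] at this
  exact hX.connected.dist_eq_zero_iff.1 this.symm

theorem sep_diff_subset (x z o : V) : X.sep x o \ X.sep z o ⊆ X.sep x z :=
  fun _ h => ⟨h.1.1, h.1.2.1, fun hz => h.2 ⟨h.1.1, hz, h.1.2.2⟩⟩

/-- The hypothesis says that `z` lies between `x` and `o`. If `k` separated `x` from `z` and
contained `o`, then `kᶜ` would separate `z`, hence also `x`, from `o`. -/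
theorem sep_diff_eq (hX : X.IsQuadrangular) {x z o : V} (h : X.sep z o ⊆ X.sep x o) :
    X.sep x o \ X.sep z o = X.sep x z := by
  refine (sep_diff_subset x z o).antisymm fun k hk => ⟨⟨hk.1, hk.2.1, fun ho => ?_⟩,
    fun hz => hk.2.2 hz.2.1⟩
  have : kᶜ ∈ X.sep z o := ⟨(hX.compl_mem_sep hk).1, hk.2.2, fun h => h ho⟩
  exact (h this).2.1 hk.2.1

theorem eq_of_sep_eq (hX : X.IsQuadrangular) {x z o : V} (h : X.sep x o = X.sep z o) : x = z :=
  hX.eq_of_sep_eq_empty <| by rw [← hX.sep_diff_eq h.ge, h, Set.sdiff_self]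

/-- Step to a neighbour `y` nearer to `o`. Unless this crosses `h`, induction gives an edge `y z`
bounding `h`, and a square moves this edge back to `x`. -/
theorem exists_adj_of_mem_minSep (hX : X.IsQuadrangular) {x o : V} {h : Set V}
    (hh : h ∈ X.minSep x o) : ∃ y, X.edgeGraph.Adj x y ∧
      X.edgeGraph.dist y o < X.edgeGraph.dist x o ∧ h = X.halfspace x y := by
  induction hn : X.edgeGraph.dist x o using Nat.strong_induction_on generalizing x with
  | _ n ih =>
    obtain ⟨hh, hmin⟩ := hh
    have hxo : x ≠ o := fun e => hh.2.2 (e ▸ hh.2.1)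
    obtain ⟨y, hxy, hlt⟩ := hX.exists_closer hxo
    by_cases hk : h = X.halfspace x y
    · exact ⟨y, hxy, hn ▸ hlt, hk⟩
    have hins := hX.sep_eq_insert hxy hlt
    have hy : h ∈ X.minSep y o := by
      refine ⟨?_, fun k hk => hmin k (hins ▸ Or.inr hk)⟩
      rw [hins] at hh
      exact hh.resolve_left hk
    obtain ⟨z, hyz, hlt', rfl⟩ := ih _ (hn ▸ hlt) hy rfl
    -- By minimality `halfspace x y` is not inside `h`. A witness `w` is closer to both `x` and `z`
    -- than to `y`, so the quadrangle property applies at `y`.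
    obtain ⟨w, hw, hw'⟩ := Set.not_subset.1 fun hsub =>
      hk (hmin _ (halfspace_mem_sep hxy hlt) hsub).symm
    rw [mem_halfspace] at hw hw'
    have hne := hX.dist_ne w hyz
    obtain ⟨c, s, -⟩ := hX.exists_sq w hxy.symm hyz (by rintro rfl; omega) hw (by omega)
    have he : X.halfspace x c = X.halfspace y z := hX.halfspace_eq_of_sq s.rotate
    refine ⟨c, s.bc, ?_, he.symm⟩
    have ho := hh.2.2
    rw [← he, mem_halfspace] at ho
    have := hX.dist_ne o s.bc
    omega

theorem finite_minSep (hX : X.IsQuadrangular) (x o : V) : (X.minSep x o).Finite :=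
  (hX.finite_sep x o).subset fun _ h => h.1

/-- Minimal halfspaces are crossed by distinct edges at `x` leading towards `o`; these pairwise span
squares, so they lie in one cube. -/
theorem ncard_minSep_le (hX : X.IsQuadrangular) (hL : X.LinkCondition) {d : ℕ}
    (hd : ∀ c : X.Cell, c.dim ≤ d) (x o : V) : (X.minSep x o).ncard ≤ d := by
  classical
  have : Nonempty V := ⟨o⟩
  choose! f hf hlt hhalf using fun h => hX.exists_adj_of_mem_minSep (x := x) (o := o) (h := h)
  have hinj : Set.InjOn f (X.minSep x o) := fun h hh k hk e => by
    rw [hhalf h hh, hhalf k hk, e]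
  rw [Set.ncard_eq_toFinset_card _ (hX.finite_minSep x o),
    ← Finset.card_image_of_injOn (f := f) (by simpa using hinj)]
  refine hL.ncard_le hd (v := x) ?_ ?_
  · intro u hu
    obtain ⟨h, hh, rfl⟩ := Finset.mem_image.1 hu
    exact hf h (by simpa using hh)
  · intro u hu w hw huw
    obtain ⟨h, hh, rfl⟩ := Finset.mem_image.1 hu
    obtain ⟨k, hk, rfl⟩ := Finset.mem_image.1 hw
    rw [Set.Finite.mem_toFinset] at hh hk
    obtain ⟨b, s, -⟩ := hX.exists_sq o (hf h hh) (hf k hk) huw (hlt h hh) (hlt k hk)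
    exact ⟨b, s⟩

theorem finite_maxSep (hX : X.IsQuadrangular) (x o : V) : (X.maxSep x o).Finite :=
  (hX.finite_sep x o).subset fun _ h => h.1

/-- Complementation turns maximal halfspaces for `(x, z)` into minimal ones for `(z, x)`. -/
theorem ncard_maxSep_le (hX : X.IsQuadrangular) (hL : X.LinkCondition) {d : ℕ}
    (hd : ∀ c : X.Cell, c.dim ≤ d) (x z : V) : (X.maxSep x z).ncard ≤ d := by
  refine le_trans (Set.ncard_le_ncard_of_injOn compl (fun h hh => ?_)
    (compl_injective.injOn) (hX.finite_minSep z x)) (hX.ncard_minSep_le hL hd z x)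
  refine ⟨hX.compl_mem_sep hh.1, fun k hk hkh => ?_⟩
  rw [← hh.2 kᶜ (hX.compl_mem_sep hk) (Set.subset_compl_comm.1 hkh), compl_compl]

/-- One can cross any set of minimal halfspaces. -/
theorem exists_sep_eq_diff (hX : X.IsQuadrangular) (o : V) (M : Finset (Set V)) :
    ∀ x, ↑M ⊆ X.minSep x o → ∃ z, X.sep z o = X.sep x o \ M := by
  classical
  induction M using Finset.induction_on with
  | empty => exact fun x _ => ⟨x, by simp⟩
  | insert h M hM ih =>
    intro x hx
    rw [Finset.coe_insert, Set.insert_subset_iff] at hx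
    obtain ⟨y, hxy, hlt, rfl⟩ := hX.exists_adj_of_mem_minSep hx.1
    have hins := hX.sep_eq_insert hxy hlt
    obtain ⟨z, hz⟩ := ih y fun k hk => by
      have hk' := hx.2 hk
      refine ⟨?_, fun l hl => hk'.2 l (hins ▸ Or.inr hl)⟩
      have := hk'.1
      rw [hins] at this
      exact this.resolve_left fun e => hM (e ▸ hk)
    refine ⟨z, ?_⟩
    rw [hz, hins, Finset.coe_insert, Set.insert_sdiff_of_mem _ (Set.mem_insert _ _),
      ← Set.union_singleton, Set.union_comm, ← Set.sdiff_sdiff,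
      Set.sdiff_singleton_eq_self halfspace_notMem_sep]

theorem exists_sep_eq_diff_minSep (hX : X.IsQuadrangular) (o x : V) :
    ∃ z, X.sep z o = X.sep x o \ X.minSep x o := by
  obtain ⟨z, hz⟩ := hX.exists_sep_eq_diff o (hX.finite_minSep x o).toFinset x (by simp)
  exact ⟨z, by simpa using hz⟩

end IsQuadrangular

end halfspaces

end CubeComplex

namespace CubeComplex

/-! ### Steps towards the base vertex and the size of intervals -/

section counting

variable {V : Type*} {X : CubeComplex V}

/-- A finite set has at most `(n + 1) ^ d` subsets with at most `d` elements. -/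
theorem card_filter_card_le {α : Type*} [DecidableEq α] (B : Finset α) (d : ℕ) :
    (B.powerset.filter fun s => s.card ≤ d).card ≤ (B.card + 1) ^ d := by
  have : (B.powerset.filter fun s => s.card ≤ d) ⊆
      (Finset.range (d + 1)).biUnion fun i => B.powersetCard i := fun s hs => by
    rw [Finset.mem_filter, Finset.mem_powerset] at hs
    exact Finset.mem_biUnion.2 ⟨s.card, Finset.mem_range.2 (Nat.lt_succ_of_le hs.2),
      Finset.mem_powersetCard.2 ⟨hs.1, rfl⟩⟩
  refine (Finset.card_le_card this).trans (Finset.card_biUnion_le.trans ?_)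
  -- Termwise comparison with the binomial expansion: `n.choose i ≤ n ^ i ≤ n ^ i * d.choose i`.
  rw [add_pow]
  refine Finset.sum_le_sum fun i hi => ?_
  rw [Finset.card_powersetCard, one_pow, mul_one]
  refine le_trans ?_ (Nat.le_mul_of_pos_right _
    (Nat.choose_pos (Nat.le_of_lt_succ (Finset.mem_range.1 hi))))
  exact Nat.choose_le_pow ..

namespace IsQuadrangular

/-- The vertex obtained from `x` by crossing all halfspaces that are adjacent to `x` and separate
it from `o`. -/
noncomputable def step (hX : X.IsQuadrangular) (o x : V) : V :=
  (hX.exists_sep_eq_diff_minSep o x).choose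

theorem sep_step (hX : X.IsQuadrangular) (o x : V) :
    X.sep (hX.step o x) o = X.sep x o \ X.minSep x o :=
  (hX.exists_sep_eq_diff_minSep o x).choose_spec

theorem dist_step_le (hX : X.IsQuadrangular) (hL : X.LinkCondition) {d : ℕ}
    (hd : ∀ c : X.Cell, c.dim ≤ d) (o x : V) : X.edgeGraph.dist x (hX.step o x) ≤ d := by
  have hsub : X.sep (hX.step o x) o ⊆ X.sep x o := by
    rw [hX.sep_step]
    exact Set.sdiff_subset
  rw [← hX.ncard_sep, ← hX.sep_diff_eq hsub, hX.sep_step,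
    Set.sdiff_sdiff_cancel_left fun h hh => hh.1]
  exact hX.ncard_minSep_le hL hd x o

theorem dist_iterate_step_le (hX : X.IsQuadrangular) (hL : X.LinkCondition) {d : ℕ}
    (hd : ∀ c : X.Cell, c.dim ≤ d) (o : V) (l : ℕ) (x : V) :
    X.edgeGraph.dist x ((hX.step o)^[l] x) ≤ d * l := by
  induction l generalizing x with
  | zero => simp
  | succ l ih =>
    rw [Function.iterate_succ_apply]
    have := hX.connected.dist_triangle (u := x) (v := hX.step o x)
      (w := (hX.step o)^[l] (hX.step o x))
    have h1 := hX.dist_step_le hL hd o x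
    have h2 := ih (hX.step o x)
    rw [Nat.mul_succ]
    omega

theorem sep_iterate_step_subset_self (hX : X.IsQuadrangular) (o : V) (l : ℕ) (x : V) :
    X.sep ((hX.step o)^[l] x) o ⊆ X.sep x o := by
  induction l generalizing x with
  | zero => exact subset_rfl
  | succ l ih =>
    rw [Function.iterate_succ_apply]
    refine (ih _).trans ?_
    rw [hX.sep_step]
    exact Set.sdiff_subset

/-- After `d(y, x)` steps from `y` towards `o` one is between `x` and `o`. -/
theorem sep_iterate_step_subset (hX : X.IsQuadrangular) (o x : V) {l : ℕ} {y : V}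
    (h : X.edgeGraph.dist y x ≤ l) : X.sep ((hX.step o)^[l] y) o ⊆ X.sep x o := by
  have h' : (X.sep y o \ X.sep x o).ncard ≤ l := by
    refine le_trans (Set.ncard_le_ncard (sep_diff_subset y x o) (hX.finite_sep y x)) ?_
    rwa [hX.ncard_sep]
  clear h
  induction l generalizing y with
  | zero =>
    rw [Nat.le_zero, Set.ncard_eq_zero ((hX.finite_sep y o).subset Set.sdiff_subset)] at h'
    exact Set.sdiff_eq_empty.1 h'
  | succ l ih =>
    rw [Function.iterate_succ_apply]
    refine ih ?_
    have hfin : (X.sep y o \ X.sep x o).Finite := (hX.finite_sep y o).subset Set.sdiff_subset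
    rcases (X.sep y o \ X.sep x o).eq_empty_or_nonempty with he | hne
    · have : X.sep (hX.step o y) o \ X.sep x o ⊆ ∅ := by
        rw [← he, hX.sep_step]
        exact Set.sdiff_subset_sdiff_left Set.sdiff_subset
      rw [Set.subset_empty_iff.1 this, Set.ncard_empty]
      exact Nat.zero_le _
    -- A halfspace minimal among those containing `y` but neither `x` nor `o` is minimal in `sep y
    -- o`, since anything smaller also misses `x`. The next step crosses it, so the count drops.
    · obtain ⟨h, hh⟩ := hfin.exists_minimal hne
      have hmin : h ∈ X.minSep y o := by
        refine ⟨hh.prop.1, fun k hk hkh => hkh.antisymm (hh.le_of_le ⟨hk, fun hkx => ?_⟩ hkh)⟩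
        exact hh.prop.2 ⟨hh.prop.1.1, hkh hkx.2.1, hh.prop.1.2.2⟩
      have hlt : (X.sep (hX.step o y) o \ X.sep x o).ncard < (X.sep y o \ X.sep x o).ncard := by
        refine Set.ncard_lt_ncard ?_ hfin
        rw [hX.sep_step]
        refine (Set.ssubset_iff_of_subset (Set.sdiff_subset_sdiff_left Set.sdiff_subset)).2
          ⟨h, hh.prop, fun hc => hc.1.2 hmin⟩
      omega

/-- The vertices between `x` and `o` at distance at most `r` from `x`. -/
def intervalBall (X : CubeComplex V) (o x : V) (r : ℕ) : Set V :=
  {z | X.sep z o ⊆ X.sep x o ∧ X.edgeGraph.dist x z ≤ r}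

/-- Each `k` lies in a maximal halfspace, which misses `z'`. Thus `maxSep x z` determines `sep x z`.
-/
theorem sep_subset_of_maxSep_eq (hX : X.IsQuadrangular) {x z z' : V}
    (h : X.maxSep x z = X.maxSep x z') : X.sep x z ⊆ X.sep x z' := by
  intro k hk
  obtain ⟨m, hkm, hm⟩ := (hX.finite_sep x z).exists_le_maximal hk
  have hm' : m ∈ X.maxSep x z := ⟨hm.prop, fun l hl hml => (hm.le_of_ge hl hml).antisymm hml⟩
  rw [h] at hm'
  exact ⟨hk.1, hk.2.1, fun hz' => hm'.1.2.2 (hkm hz')⟩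

/-- From `x`, `r` steps reach beyond every such `z`, so the halfspaces separating `x` from `z` are
among the at most `d * r` crossed. The vertex `z` is recovered from its at most `d` maximal ones. -/
theorem intervalBall_finite_and_ncard_le (hX : X.IsQuadrangular) (hL : X.LinkCondition) {d : ℕ}
    (hd : ∀ c : X.Cell, c.dim ≤ d) (o x : V) (r : ℕ) :
    (intervalBall X o x r).Finite ∧ (intervalBall X o x r).ncard ≤ (d * r + 1) ^ d := by
  classical
  let B : Set (Set V) := X.sep x ((hX.step o)^[r] x)
  have hB : B.Finite := hX.finite_sep _ _
  have hBcard : hB.toFinset.card ≤ d * r := by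
    rw [← Set.ncard_eq_toFinset_card _ hB, hX.ncard_sep]
    exact hX.dist_iterate_step_le hL hd o r x
  let T : Finset (Finset (Set V)) := hB.toFinset.powerset.filter fun s => s.card ≤ d
  let f : V → Finset (Set V) := fun z => (hX.finite_maxSep x z).toFinset
  have hmaps : ∀ z ∈ intervalBall X o x r, f z ∈ (T : Set (Finset (Set V))) := by
    intro z hz
    simp only [T, f, Finset.coe_filter, Finset.mem_powerset, Set.Finite.toFinset_subset_toFinset,
      Set.mem_ofPred_eq]
    constructor
    · intro k hk
      have hsub := hX.sep_iterate_step_subset o z (l := r) (y := x) hz.2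
      change k ∈ X.sep x ((hX.step o)^[r] x)
      rw [← hX.sep_diff_eq (hX.sep_iterate_step_subset_self o r x)]
      have hk' := hk.1
      rw [← hX.sep_diff_eq hz.1] at hk'
      exact ⟨hk'.1, fun h => hk'.2 (hsub h)⟩
    · rw [← Set.ncard_eq_toFinset_card _ (hX.finite_maxSep x z)]
      exact hX.ncard_maxSep_le hL hd x z
  have hinj : Set.InjOn f (intervalBall X o x r) := by
    intro z hz z' hz' h
    have h' : X.maxSep x z = X.maxSep x z' := by simpa [f] using h
    have hs : X.sep x z = X.sep x z' := (hX.sep_subset_of_maxSep_eq h').antisymm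
      (hX.sep_subset_of_maxSep_eq h'.symm)
    rw [← hX.sep_diff_eq hz.1, ← hX.sep_diff_eq hz'.1] at hs
    refine hX.eq_of_sep_eq (o := o) ?_
    rw [← Set.sdiff_sdiff_cancel_left hz.1, hs, Set.sdiff_sdiff_cancel_left hz'.1]
  refine ⟨Set.Finite.of_injOn hmaps hinj T.finite_toSet, ?_⟩
  calc (intervalBall X o x r).ncard ≤ (T : Set (Finset (Set V))).ncard :=
        Set.ncard_le_ncard_of_injOn f hmaps hinj T.finite_toSet
    _ = T.card := Set.ncard_coe_finset T
    _ ≤ (hB.toFinset.card + 1) ^ d := card_filter_card_le _ d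
    _ ≤ (d * r + 1) ^ d := Nat.pow_le_pow_left (Nat.succ_le_succ hBcard) d

/-- The points reached in `l` steps towards `o` from the ball of radius `k` around `x`. -/
def shadow (hX : X.IsQuadrangular) (o : V) (l : ℕ) (x : V) (k : ℕ) : Set V :=
  (hX.step o)^[l] '' {y | X.edgeGraph.dist x y ≤ k}

theorem shadow_subset (hX : X.IsQuadrangular) (hL : X.LinkCondition) {d : ℕ}
    (hd : ∀ c : X.Cell, c.dim ≤ d) (o x : V) {k l : ℕ} (hkl : k ≤ l) :
    hX.shadow o l x k ⊆ intervalBall X o x ((d + 1) * l) := by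
  rintro _ ⟨y, hy, rfl⟩
  have hy' : X.edgeGraph.dist x y ≤ k := hy
  -- The radius splits as at most `k ≤ l` from `x` to `y`, then at most `d * l` for the steps.
  refine ⟨hX.sep_iterate_step_subset o x (by rw [SimpleGraph.dist_comm]; omega), ?_⟩
  have h1 := hX.connected.dist_triangle (u := x) (v := y) (w := (hX.step o)^[l] y)
  have h2 := hX.dist_iterate_step_le hL hd o l y
  rw [Nat.succ_mul]
  omega

theorem shadow_subset_shadow (hX : X.IsQuadrangular) (o : V) (l : ℕ) {x y : V} {k R : ℕ}
    (hxy : X.edgeGraph.dist x y ≤ R) : hX.shadow o l x k ⊆ hX.shadow o l y (k + R) := by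
  refine Set.image_mono fun z hz => ?_
  have hz' : X.edgeGraph.dist x z ≤ k := hz
  have := hX.connected.dist_triangle (u := y) (v := x) (w := z)
  rw [SimpleGraph.dist_comm] at hxy
  change X.edgeGraph.dist y z ≤ k + R
  omega

theorem shadow_nonempty (hX : X.IsQuadrangular) (o : V) (l : ℕ) (x : V) (k : ℕ) :
    (hX.shadow o l x k).Nonempty :=
  ⟨_, x, by simp, rfl⟩

end IsQuadrangular

end counting

end CubeComplex

/-! ### From polynomial growth to Property A -/

section propertyA

open Filter Topology

variable {V : Type*}

theorem lp_one_norm_eq_sum (f : lp (fun _ : V => ℝ) 1) (T : Finset V) (h : ∀ v ∉ T, f v = 0) :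
    ‖f‖ = ∑ v ∈ T, |f v| := by
  rw [lp.norm_eq_tsum_rpow (by simp)]
  simp only [ENNReal.toReal_one, Real.rpow_one, div_one, Real.norm_eq_abs]
  exact tsum_eq_sum fun v hv => by rw [h v hv, abs_zero]

/-- The uniform probability distribution on a finite set, as an element of `ℓ¹`. -/
noncomputable def uniformDist (A : Finset V) : lp (fun _ : V => ℝ) 1 :=
  open Classical in
  ⟨fun v => if v ∈ A then (A.card : ℝ)⁻¹ else 0, memℓp_gen <|
    summable_of_ne_finset_zero (s := A) fun v hv => by simp [hv]⟩

open Classical in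
theorem uniformDist_apply (A : Finset V) (v : V) :
    uniformDist A v = if v ∈ A then (A.card : ℝ)⁻¹ else 0 := by
  rw [uniformDist]

theorem uniformDist_nonneg (A : Finset V) (v : V) : 0 ≤ uniformDist A v := by
  rw [uniformDist_apply]
  split_ifs <;> positivity

theorem sum_uniformDist {A T : Finset V} (hA : A.Nonempty) (h : A ⊆ T) :
    ∑ v ∈ T, uniformDist A v = 1 := by
  classical
  have : (A.card : ℝ) ≠ 0 := by exact_mod_cast hA.card_pos.ne'
  simp only [uniformDist_apply]
  rw [Finset.sum_ite_mem, Finset.inter_eq_right.2 h, Finset.sum_const, nsmul_eq_mul,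
    mul_inv_cancel₀ this]

/-- The distributions overlap in mass at least `|C| / |D|`, and `1 - |C| / |D| ≤ log (|D| / |C|)`.
The logarithmic form is chosen because it telescopes. -/
theorem norm_uniformDist_sub_le {A B C D : Finset V} (hC : C.Nonempty) (hCA : C ⊆ A) (hCB : C ⊆ B)
    (hAD : A ⊆ D) (hBD : B ⊆ D) :
    ‖uniformDist A - uniformDist B‖ ≤ 2 * (Real.log D.card - Real.log C.card) := by
  have hc : (0 : ℝ) < C.card := by exact_mod_cast hC.card_pos
  have hCD : (C.card : ℝ) ≤ D.card := by exact_mod_cast Finset.card_le_card (hCA.trans hAD)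
  have hd : (0 : ℝ) < D.card := hc.trans_le hCD
  have hmin : ∑ v ∈ D, min (uniformDist A v) (uniformDist B v) ≥ C.card / D.card := by
    calc ∑ v ∈ D, min (uniformDist A v) (uniformDist B v)
        ≥ ∑ v ∈ C, min (uniformDist A v) (uniformDist B v) :=
          Finset.sum_le_sum_of_subset_of_nonneg (hCA.trans hAD) fun v _ _ =>
            le_min (uniformDist_nonneg A v) (uniformDist_nonneg B v)
      _ ≥ ∑ v ∈ C, (D.card : ℝ)⁻¹ := by
          refine Finset.sum_le_sum fun v hv => ?_
          rw [uniformDist_apply, uniformDist_apply, if_pos (hCA hv), if_pos (hCB hv)]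
          have hA : (0 : ℝ) < A.card := by exact_mod_cast (hC.mono hCA).card_pos
          have hB : (0 : ℝ) < B.card := by exact_mod_cast (hC.mono hCB).card_pos
          refine le_min (inv_anti₀ hA ?_) (inv_anti₀ hB ?_)
          · exact_mod_cast Finset.card_le_card hAD
          · exact_mod_cast Finset.card_le_card hBD
      _ = C.card / D.card := by rw [Finset.sum_const, nsmul_eq_mul, div_eq_mul_inv]
  rw [lp_one_norm_eq_sum _ D fun v hv => by
    rw [lp.coeFn_sub, Pi.sub_apply, uniformDist_apply, uniformDist_apply,
      if_neg fun h => hv (hAD h), if_neg fun h => hv (hBD h), sub_zero]]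
  have habs : ∀ v ∈ D, |(uniformDist A - uniformDist B : lp (fun _ : V => ℝ) 1) v| =
      uniformDist A v + uniformDist B v - 2 * min (uniformDist A v) (uniformDist B v) :=
    fun v _ => by
      rw [lp.coeFn_sub, Pi.sub_apply]
      rcases le_total (uniformDist A v) (uniformDist B v) with h | h
      · rw [min_eq_left h, abs_of_nonpos (by linarith)]
        ring
      · rw [min_eq_right h, abs_of_nonneg (by linarith)]
        ring
  rw [Finset.sum_congr rfl habs, Finset.sum_sub_distrib, Finset.sum_add_distrib, ← Finset.mul_sum,
    sum_uniformDist (hC.mono hCA) hAD, sum_uniformDist (hC.mono hCB) hBD]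
  have hlog := Real.one_sub_inv_le_log_of_pos (div_pos hd hc)
  rw [Real.log_div hd.ne' hc.ne', inv_div] at hlog
  linarith

theorem sum_shift_sub_le {a : ℕ → ℝ} {L : ℝ} (n m : ℕ) (h0 : ∀ k, 0 ≤ a k)
    (hL : ∀ k ≤ n + m, a k ≤ L) :
    ∑ k ∈ Finset.range n, (a (k + m) - a k) ≤ m * L := by
  have h1 := Finset.sum_range_add a m n
  have h2 := Finset.sum_range_add a n m
  rw [add_comm m n, h2] at h1
  have h3 : ∑ k ∈ Finset.range m, a (n + k) ≤ m * L := by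
    refine (Finset.sum_le_card_nsmul _ _ L fun k hk => hL _ ?_).trans ?_
    · have := Finset.mem_range.1 hk
      omega
    · simp
  have h4 : 0 ≤ ∑ k ∈ Finset.range m, a k := Finset.sum_nonneg fun k _ => h0 k
  rw [Finset.sum_sub_distrib]
  simp only [add_comm _ m]
  linarith

theorem exists_mul_log_pow_le (c d m : ℕ) {ε : ℝ} (hε : 0 < ε) :
    ∃ n : ℕ, 0 < n ∧ m * Real.log (((c * (n + m) + 1) ^ d : ℕ) : ℝ) ≤ ε * n := by
  -- Chosen so that `c * (n + m) + 1 ≤ K * n` for `n ≥ 1`.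
  let K : ℝ := c * (1 + m) + 1
  have hK : 0 < K := by positivity
  have hlim : Tendsto (fun n : ℕ => m * d * (Real.log K / (n : ℝ) + Real.log n / n)) atTop
      (𝓝 0) := by
    have h1 : Tendsto (fun n : ℕ => Real.log K / (n : ℝ)) atTop (𝓝 0) :=
      tendsto_const_div_atTop_nhds_zero_nat _
    have h2 : Tendsto (fun n : ℕ => Real.log n / (n : ℝ)) atTop (𝓝 0) := by
      have := (Real.tendsto_pow_log_div_mul_add_atTop 1 0 1 one_ne_zero).comp
        tendsto_natCast_atTop_atTop
      simpa [Function.comp_def] using this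
    simpa using (h1.add h2).const_mul ((m : ℝ) * d)
  obtain ⟨n, hn, hpos⟩ := ((hlim.eventually_lt_const hε).and (eventually_gt_atTop 0)).exists
  refine ⟨n, hpos, ?_⟩
  have hn' : (0 : ℝ) < n := by exact_mod_cast hpos
  have h1 : (1 : ℝ) ≤ n := by exact_mod_cast hpos
  have hle : ((c * (n + m) + 1 : ℕ) : ℝ) ≤ K * n := by
    push_cast
    have hm : (m : ℝ) ≤ m * n := le_mul_of_one_le_right (by positivity) h1
    have hcm : (c : ℝ) * m ≤ c * (m * n) := mul_le_mul_of_nonneg_left hm (by positivity)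
    simp only [K]
    nlinarith
  have hlog : Real.log ((c * (n + m) + 1 : ℕ) : ℝ) ≤ Real.log K + Real.log n := by
    rw [← Real.log_mul hK.ne' hn'.ne']
    exact Real.log_le_log (by positivity) hle
  rw [Nat.cast_pow, Real.log_pow]
  calc (m : ℝ) * (d * Real.log ((c * (n + m) + 1 : ℕ) : ℝ))
      ≤ m * (d * (Real.log K + Real.log n)) := by gcongr
    _ = (m * d * (Real.log K / (n : ℝ) + Real.log n / n)) * n := by field_simp
    _ ≤ ε * n := by gcongr

/-- A space has Property A if to each point one can attach increasing families of sets that grow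
polynomially and are comparable for nearby points. -/
theorem hasPropertyA_of_shadows [MetricSpace V] (S : ℕ → V → ℕ → Set V) (c d : ℕ)
    (hne : ∀ l x k, (S l x k).Nonempty)
    (hfin : ∀ l x k, k ≤ l → (S l x k).Finite ∧ (S l x k).ncard ≤ (c * l + 1) ^ d)
    (hsub : ∀ l x y k (R : ℕ), dist x y ≤ R → S l x k ⊆ S l y (k + R))
    (hball : ∀ l, ∃ s > (0 : ℝ), ∀ x k, k ≤ l → S l x k ⊆ Metric.closedBall x s) :
    HasPropertyA V := by
  classical
  intro R₀ _ ε hε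
  let R := ⌈R₀⌉₊
  obtain ⟨n, hn, hle⟩ := exists_mul_log_pow_le c d (2 * R) (half_pos hε)
  have hn' : (0 : ℝ) < n := by exact_mod_cast hn
  -- Large enough for every index `k + 2 * R` with `k < n`.
  let l := n + 2 * R
  let A : V → ℕ → Finset V := fun x k =>
    if h : k ≤ l then (hfin l x k h).1.toFinset else {x}
  have hA : ∀ x k, k ≤ l → (A x k : Set V) = S l x k := fun x k h => by simp [A, h]
  have hAne : ∀ x k, (A x k).Nonempty := fun x k => by
    by_cases h : k ≤ l
    · rw [← Finset.coe_nonempty, hA x k h]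
      exact hne l x k
    · simp [A, h]
  have hAsub : ∀ x y k, dist x y ≤ R → k + R ≤ l → A x k ⊆ A y (k + R) := fun x y k hxy hk => by
    rw [← Finset.coe_subset, hA x k (by omega), hA y _ hk]
    exact hsub l x y k R hxy
  have hAcard : ∀ x k, k ≤ l → (A x k).card ≤ (c * l + 1) ^ d := fun x k hk => by
    rw [← Set.ncard_coe_finset, hA x k hk]
    exact (hfin l x k hk).2
  let ξ : V → lp (fun _ : V => ℝ) 1 := fun x =>
    (n : ℝ)⁻¹ • ∑ k ∈ Finset.range n, uniformDist (A x (k + R))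
  have hξ : ∀ x v, ξ x v = (n : ℝ)⁻¹ * ∑ k ∈ Finset.range n, uniformDist (A x (k + R)) v :=
    fun x v => by simp only [ξ, lp.coeFn_smul, lp.coeFn_sum, Pi.smul_apply, Finset.sum_apply,
      smul_eq_mul]
  have hzero : ∀ x v, (∀ k ∈ Finset.range n, v ∉ A x (k + R)) → ξ x v = 0 := fun x v h => by
    rw [hξ, Finset.sum_eq_zero fun k hk => by rw [uniformDist_apply, if_neg (h k hk)], mul_zero]
  refine ⟨ξ, fun x => ?_, fun x y hxy => ?_, ?_⟩
  · let T := (Finset.range n).biUnion fun k => A x (k + R)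
    have hT : ∀ k ∈ Finset.range n, A x (k + R) ⊆ T := fun k hk =>
      Finset.subset_biUnion_of_mem (fun k => A x (k + R)) hk
    rw [lp_one_norm_eq_sum _ T fun v hv => hzero x v fun k hk h => hv (hT k hk h)]
    calc ∑ v ∈ T, |ξ x v|
        = ∑ v ∈ T, (n : ℝ)⁻¹ * ∑ k ∈ Finset.range n, uniformDist (A x (k + R)) v := by
          refine Finset.sum_congr rfl fun v _ => ?_
          rw [hξ, abs_of_nonneg]
          exact mul_nonneg (by positivity) (Finset.sum_nonneg fun k _ => uniformDist_nonneg _ _)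
      _ = (n : ℝ)⁻¹ * ∑ k ∈ Finset.range n, ∑ v ∈ T, uniformDist (A x (k + R)) v := by
          rw [← Finset.mul_sum, Finset.sum_comm]
      _ = (n : ℝ)⁻¹ * ∑ k ∈ Finset.range n, (1 : ℝ) := by
          rw [Finset.sum_congr rfl fun k hk => sum_uniformDist (hAne x _) (hT k hk)]
      _ = 1 := by simp [hn'.ne']
  · have hxy' : dist x y ≤ R := hxy.trans (Nat.le_ceil R₀)
    have hxx : dist x x ≤ R := by simp
    have hyx : dist y x ≤ R := by rwa [dist_comm]
    have hbound : ∀ k ∈ Finset.range n,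
        ‖uniformDist (A x (k + R)) - uniformDist (A y (k + R))‖ ≤
          2 * (Real.log (A x (k + 2 * R)).card - Real.log (A x k).card) := fun k hk => by
      have hk := Finset.mem_range.1 hk
      -- The sets at `x` and `y` with index `k + R` both contain `A x k` and lie in `A x (k + 2 *
      -- R)`.
      have e : k + 2 * R = k + R + R := by ring
      rw [e]
      exact norm_uniformDist_sub_le (hAne x k) (hAsub x x k hxx (by omega))
        (hAsub x y k hxy' (by omega)) (hAsub x x _ hxx (by omega)) (hAsub y x _ hyx (by omega))
    let a : ℕ → ℝ := fun k => Real.log (A x k).card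
    have ha0 : ∀ k, 0 ≤ a k := fun k => Real.log_natCast_nonneg _
    have haL : ∀ k ≤ n + 2 * R, a k ≤ Real.log (((c * (n + 2 * R) + 1) ^ d : ℕ) : ℝ) :=
      fun k hk => Real.log_le_log (by exact_mod_cast (hAne x k).card_pos)
        (by exact_mod_cast hAcard x k hk)
    have hsum := sum_shift_sub_le n (2 * R) ha0 haL
    calc ‖ξ x - ξ y‖ = (n : ℝ)⁻¹ *
          ‖∑ k ∈ Finset.range n, (uniformDist (A x (k + R)) - uniformDist (A y (k + R)))‖ := by
          simp only [ξ]
          rw [← smul_sub, ← Finset.sum_sub_distrib, norm_smul, Real.norm_of_nonneg (by positivity)]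
      _ ≤ (n : ℝ)⁻¹ * ∑ k ∈ Finset.range n, 2 * (a (k + 2 * R) - a k) := by
          gcongr
          exact (norm_sum_le _ _).trans (Finset.sum_le_sum hbound)
      _ ≤ (n : ℝ)⁻¹ * (2 * (ε / 2 * n)) := by
          rw [← Finset.mul_sum]
          gcongr
          exact hsum.trans hle
      _ = ε := by field_simp
  · obtain ⟨s, hs, hball⟩ := hball l
    refine ⟨s, hs, fun x v hv => ?_⟩
    by_contra hvs
    refine hv (hzero x v fun k hk h => hvs ?_)
    have hk := Finset.mem_range.1 hk
    refine hball x (k + R) (by omega) ?_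
    rw [← hA x _ (by omega)]
    exact h

end propertyA

theorem mainTheorem3 {V : Type*} (X : CubeComplex V) (hX : X.IsCAT0)
    (hdim : X.IsFiniteDimensional) :
    ∃ hconn : X.edgeGraph.Connected, @HasPropertyA V (edgePathMetric hconn) := by
  obtain ⟨d, hd⟩ := hdim
  have hQ := hX.isQuadrangular
  have hL := hX.linkCondition
  refine ⟨hQ.connected, ?_⟩
  obtain ⟨o⟩ := hQ.connected.nonempty
  let := edgePathMetric hQ.connected
  have hdist : ∀ x y : V, dist x y = (X.edgeGraph.dist x y : ℝ) := fun _ _ => rfl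
  refine hasPropertyA_of_shadows (hQ.shadow o) (d * (d + 1)) d (hQ.shadow_nonempty o)
    (fun l x k hk => ?_) (fun l x y k R hxy => ?_) fun l => ?_
  · obtain ⟨hf, hc⟩ := hQ.intervalBall_finite_and_ncard_le hL hd o x ((d + 1) * l)
    have hsub := hQ.shadow_subset hL hd o x hk
    refine ⟨hf.subset hsub, (Set.ncard_le_ncard hsub hf).trans ?_⟩
    rwa [mul_assoc]
  · rw [hdist] at hxy
    exact hQ.shadow_subset_shadow o l (by exact_mod_cast hxy)
  -- Adding one keeps the radius positive when `l = 0`.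
  · refine ⟨((d + 1) * l : ℕ) + 1, by positivity, fun x k hk z hz => ?_⟩
    have hz' : X.edgeGraph.dist x z ≤ (d + 1) * l := (hQ.shadow_subset hL hd o x hk hz).2
    rw [Metric.mem_closedBall, dist_comm, hdist]
    have : (X.edgeGraph.dist x z : ℝ) ≤ ((d + 1) * l : ℕ) := by exact_mod_cast hz'
    linarith
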